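/- Let $M$ be a von Neumann algebra acting on a complex Hilbert space and let $\tau$ be a faithful normal tracial state on $M$ (so $(M,\tau)$ is a finite von Neumann algebra with a trace). The spectral measure $\mu_a$ of a normal element $a\in M$ is the Borel measure on $\mathbb{C}$ with $\int f\,d\mu_a=\tau(f(a))$ for all continuous compactly supported $f$. The spectral measure of a normal $n\times n$ matrix gives mass $1/n$ to each eigenvalue, counted with multiplicity. A normal operator $a\in M$ is called integer if $\mu_a$ is the weak limit of the spectral measures of a sequence of normal matrices $B_k\in M_{n_k}(\mathbb{Z})$, $n_k\ge 1$, with $\sup_k\|B_k\|<\infty$. For $A=A^*\in M$, the distribution function of its spectral measure is $R_A(t)=\tau(1_{(-\infty,t)}(A))$, $t\in\mathbb{R}$. An algebraic integer is totally real if all its Galois conjugates are real; for such $\alpha$ let $\mu_\alpha$ be the measure giving mass $1/\deg(\alpha)$ to each conjugate of $\alpha$. **Theorem.** Let $A=A^*\in M$ be an integer operator. Then $R_A=R_A^a+R_A^c$, where: 1. $R_A^a$ is a (possibly infinite) step function: there is a summable family of weights $w(x)\ge 0$, $x\in\mathbb{R}$, with $R_A^a(t)=\sum_{x<t}w(x)$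 for all $t$. Every jump point $x$ (i.e. $w(x)\neq 0$) is a totally real algebraic integer, and every Galois conjugate of a jump point is a jump point, with a jump of the same size. 2. $R_A^c$ is continuous and, normalized by its total mass $c=1-\sum_x w(x)$, is a uniform limit of distribution functions of convex combinations of measures $\mu_\alpha$: there are measures $\nu_1,\nu_2,\dots$ on $\mathbb{R}$, each a finite convex combination of measures $\mu_{\alpha}$ with $\alpha$ a totally real algebraic integer, such that $c\cdot\nu_k((-\infty,t))\to R_A^c(t)$ uniformly in $t\in\mathbb{R}$. -/

import Mathlib

open MeasureTheory Filter Topology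
open scoped ComplexOrder NNReal ENNReal CompactlySupported BoundedContinuousFunction

noncomputable section

universe u

namespace FiniteVN

variable {H : Type u} [NormedAddCommGroup H] [InnerProductSpace ℂ H] [CompleteSpace H]

/-- A faithful normal tracial state `τ` on a von Neumann algebra `M` acting on a Hilbert space `H`;
a pair `(M, τ)` is a finite von Neumann algebra with a trace. The order on operators is the
Loewner order. -/
structure Trace (M : VonNeumannAlgebra H) where
  /-- the underlying linear functional -/
  toFun : M.toStarSubalgebra →ₗ[ℂ] ℂ
  map_one : toFun 1 = 1
  nonneg : ∀ x : M.toStarSubalgebra, 0 ≤ (x : H →L[ℂ] H) → 0 ≤ toFun x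
  tracial : ∀ x y : M.toStarSubalgebra, toFun (x * y) = toFun (y * x)
  faithful : ∀ x : M.toStarSubalgebra, toFun (star x * x) = 0 → x = 0
  /-- `τ` preserves suprema of bounded upward directed sets of positive elements. -/
  normal : ∀ (S : Set M.toStarSubalgebra) (x : M.toStarSubalgebra), S.Nonempty →
    (∀ y ∈ S, 0 ≤ (y : H →L[ℂ] H)) →
    DirectedOn (fun y z : M.toStarSubalgebra => (y : H →L[ℂ] H) ≤ (z : H →L[ℂ] H)) S →
    IsLUB ((fun y : M.toStarSubalgebra => (y : H →L[ℂ] H)) '' S) (x : H →L[ℂ] H) →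
    IsLUB ((fun y => (toFun y).re) '' S) (toFun x).re

variable {M : VonNeumannAlgebra H}

/-- An operator commuting with everything that commutes with `M` lies in `M`. -/
theorem mem_of_commute {T : H →L[ℂ] H}
    (h : ∀ S : H →L[ℂ] H, (∀ x ∈ M.toStarSubalgebra, Commute x S) → Commute T S) :
    T ∈ M.toStarSubalgebra := by
  have h2 : T ∈ Set.centralizer (Set.centralizer (M : Set (H →L[ℂ] H))) := by
    intro S hS
    exact (h S (fun x hx => hS x hx)).eq.symm
  rw [M.centralizer_centralizer] at h2
  exact h2

theorem cfc_mem (a : M.toStarSubalgebra) (f : ℂ → ℂ) :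
    cfc f (a : H →L[ℂ] H) ∈ M.toStarSubalgebra :=
  mem_of_commute fun _ hS =>
    Commute.cfc (hS _ a.2) (hS _ (star_mem a.2)) f

theorem cfc_real_mem (a : M.toStarSubalgebra) (f : ℝ → ℝ) :
    cfc f (a : H →L[ℂ] H) ∈ M.toStarSubalgebra :=
  mem_of_commute fun _ hS => Commute.cfc_real (hS _ a.2) f

/-- The continuous functional calculus `f(a) ∈ M` of an element `a ∈ M` (for `a` normal). -/
def functionalCalculus (a : M.toStarSubalgebra) (f : ℂ → ℂ) : M.toStarSubalgebra :=
  ⟨cfc f (a : H →L[ℂ] H), cfc_mem a f⟩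

namespace Trace

variable (τ : Trace M)

/-- The positive linear functional `f ↦ τ(f(a))` on compactly supported continuous real functions
on `ℂ`, for a normal element `a ∈ M`. -/
def spectralFunctional (a : M.toStarSubalgebra) (_ha : IsStarNormal (a : H →L[ℂ] H)) :
    C_c(ℂ, ℝ) →ₚ[ℝ] ℝ :=
  PositiveLinearMap.mk₀
    { toFun := fun f => (τ.toFun (functionalCalculus a (fun z => ((f z : ℝ) : ℂ)))).re
      map_add' := by
        intro f g
        have h : functionalCalculus a (fun z => (((f + g) z : ℝ) : ℂ))
            = functionalCalculus a (fun z => ((f z : ℝ) : ℂ))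
              + functionalCalculus a (fun z => ((g z : ℝ) : ℂ)) := by
          apply Subtype.ext
          simp only [functionalCalculus, CompactlySupportedContinuousMap.coe_add, Pi.add_apply,
            Complex.ofReal_add]
          exact cfc_add _ _ _ (by fun_prop) (by fun_prop)
        rw [h, map_add, Complex.add_re]
      map_smul' := by
        intro r f
        have h : functionalCalculus a (fun z => (((r • f) z : ℝ) : ℂ))
            = (r : ℂ) • functionalCalculus a (fun z => ((f z : ℝ) : ℂ)) := by
          apply Subtype.ext
          simp only [functionalCalculus, CompactlySupportedContinuousMap.coe_smul, Pi.smul_apply,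
            smul_eq_mul, Complex.ofReal_mul]
          exact cfc_const_mul _ _ _ (by fun_prop)
        rw [h, map_smul, smul_eq_mul, Complex.re_ofReal_mul]
        rfl }
    (by
      intro f hf
      have h : 0 ≤ τ.toFun (functionalCalculus a (fun z => ((f z : ℝ) : ℂ))) := by
        apply τ.nonneg
        exact cfc_nonneg fun z _ => Complex.zero_le_real.mpr (hf z)
      exact (Complex.le_def.mp h).1)

/-- The spectral measure `μ_a` of a normal element `a` of `(M, τ)`: the Borel measure on `ℂ` with
`∫ f dμ_a = τ(f(a))` for all compactly supported continuous `f`. -/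
def spectralMeasure (a : M.toStarSubalgebra) (ha : IsStarNormal (a : H →L[ℂ] H)) : Measure ℂ :=
  RealRMK.rieszMeasure (τ.spectralFunctional a ha)

end Trace

/-- The spectral measure (with respect to the normalized trace) of a complex `n × n` matrix: every
eigenvalue, counted with multiplicity, has mass `1 / n`. -/
def matrixSpectralMeasure {n : ℕ} (B : Matrix (Fin n) (Fin n) ℂ) : Measure ℂ :=
  (n : ℝ≥0∞)⁻¹ • (B.charpoly.roots.map (fun z => Measure.dirac z)).sum

/-- A normal operator `a ∈ M` is integer if its spectral measure is the weak limit of the spectral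
measures of a sequence of normal integer matrices of uniformly bounded operator norm. -/
def Trace.IsInteger (τ : Trace M) (a : M.toStarSubalgebra) : Prop :=
  ∃ ha : IsStarNormal (a : H →L[ℂ] H),
  ∃ (n : ℕ → ℕ) (B : ∀ k, Matrix (Fin (n k)) (Fin (n k)) ℤ),
    (∀ k, 0 < n k) ∧
    (∀ k, IsStarNormal ((B k).map (Int.cast : ℤ → ℂ))) ∧
    (∃ C : ℝ, ∀ k, ‖Matrix.toEuclideanCLM (𝕜 := ℂ) ((B k).map (Int.cast : ℤ → ℂ))‖ ≤ C) ∧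
    ∀ f : ℂ →ᵇ ℝ,
      Tendsto (fun k => ∫ z, f z ∂(matrixSpectralMeasure ((B k).map (Int.cast : ℤ → ℂ))))
        atTop (𝓝 (∫ z, f z ∂(τ.spectralMeasure a ha)))

/-- The spectral projection `1_{(-∞, t)}(A)` of a self-adjoint operator `A`. The function
`s ↦ max (t - s) 0` is continuous and its support is exactly `(-∞, t)`, so the projection is the
range projection of this function of `A`. -/
def spectralProjection (A : H →L[ℂ] H) (t : ℝ) : H →L[ℂ] H :=
  (LinearMap.range
    (cfc (fun s : ℝ => max (t - s) 0) A).toLinearMap).topologicalClosure.starProjection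

theorem spectralProjection_mem (A : M.toStarSubalgebra) (t : ℝ) :
    spectralProjection (A : H →L[ℂ] H) t ∈ M.toStarSubalgebra := by
  have hT := cfc_real_mem A (fun s : ℝ => max (t - s) 0)
  unfold spectralProjection
  set T : H →L[ℂ] H := cfc (fun s : ℝ => max (t - s) 0) (A : H →L[ℂ] H)
  set K : Submodule ℂ H := (LinearMap.range T.toLinearMap).topologicalClosure
  have key : ∀ S : H →L[ℂ] H, Commute T S → ∀ v ∈ K, S v ∈ K := by
    intro S hS
    have h1 : LinearMap.range T.toLinearMap ≤ K.comap S.toLinearMap := by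
      rintro _ ⟨x, rfl⟩
      refine Submodule.le_topologicalClosure _ ⟨S x, ?_⟩
      exact congrArg (fun R : H →L[ℂ] H => R x) hS.eq
    refine fun v hv => Submodule.topologicalClosure_minimal _ h1 ?_ hv
    exact (Submodule.isClosed_topologicalClosure _).preimage S.continuous
  refine mem_of_commute fun S hS => ?_
  have hK : ∀ v ∈ K, S v ∈ K := key S (hS T hT)
  have hK' : ∀ v ∈ Kᗮ, S v ∈ Kᗮ := by
    intro v hv
    rw [Submodule.mem_orthogonal] at hv ⊢
    intro u hu
    rw [← ContinuousLinearMap.adjoint_inner_left]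
    refine hv _ (key _ ?_ u hu)
    have h2 := (hS (star T) (star_mem hT)).star_star
    rwa [_root_.star_star] at h2
  refine ContinuousLinearMap.ext fun x => ?_
  change K.starProjection (S x) = S (K.starProjection x)
  exact Submodule.eq_starProjection_of_mem_of_inner_eq_zero
    (hK _ (Submodule.starProjection_apply_mem K x)) (by
      intro w hw
      rw [← map_sub]
      exact Submodule.inner_left_of_mem_orthogonal hw
        (hK' _ (Submodule.sub_starProjection_mem_orthogonal x)))

/-- The distribution function `R_A(t) = τ(1_{(-∞, t)}(A))` of the spectral measure of a
self-adjoint `A ∈ M`. -/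
def Trace.distributionFunction (τ : Trace M) (A : M.toStarSubalgebra) (t : ℝ) : ℝ :=
  (τ.toFun ⟨spectralProjection (A : H →L[ℂ] H) t, spectralProjection_mem A t⟩).re

/-- `α` is an algebraic integer all of whose Galois conjugates in `ℂ` are real. -/
def IsTotallyRealInteger (α : ℝ) : Prop :=
  IsIntegral ℤ α ∧ ∀ z : ℂ, IsConjRoot ℚ (α : ℂ) z → z.im = 0

/-- For a totally real algebraic integer `α`, the measure `μ_α` with mass `1 / deg α` at each of
the conjugates of `α`. -/
def conjugateMeasure (α : ℝ) : Measure ℝ :=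
  ((minpoly ℚ α).natDegree : ℝ≥0∞)⁻¹ •
    ∑ β ∈ ((minpoly ℚ α).aroots ℝ).toFinset, Measure.dirac β

/-- `ν` is a (finite) convex combination of measures `μ_α` of totally real algebraic integers. -/
def IsConvexCombination (ν : Measure ℝ) : Prop :=
  ∃ (m : ℕ) (c : Fin m → ℝ≥0) (α : Fin m → ℝ),
    ∑ i, c i = 1 ∧ (∀ i, IsTotallyRealInteger (α i)) ∧ ν = ∑ i, c i • conjugateMeasure (α i)

/-- The (left-continuous) step function with a jump of size `w x` at `x`, for every `x`. -/
def stepFunction (w : ℝ → ℝ) (t : ℝ) : ℝ :=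
  ∑' x, (Set.Iio t).indicator w x

end FiniteVN

end

/-! ### Integrality of products of roots and multiplicities of conjugates -/

section

open Polynomial

/-! Everything rests on the fact that a nonzero integer has modulus at least one. For a monic
integer polynomial, the product of the nonzero roots and the product of the nonzero differences of
roots are nonzero integers (`Polynomial.one_le_norm_prod_filter_ne_zero_aroots`,
`Polynomial.one_le_norm_prod_offDiagPairs_aroots`). If all roots lie in a fixed disc, the factors
are bounded above, so the proportion of factors smaller than `δ` is `O(1 / log δ⁻¹)`, uniformly in
the polynomial.

This gives two estimates. First, roots cannot pile up near a point `x` without being equal to `x`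
(`Polynomial.exists_card_filter_ball_le`): numbers of high relative multiplicity have bounded degree
and bounded conjugates, so they form a finite set that a small ball avoids, and the remaining roots
would produce too many close pairs of distinct roots. Hence weak convergence of the matrix spectral
measures forces convergence of the mass of every point. Secondly, for `B` normal the numbers `z -
conj z` are the eigenvalues of the integer matrix `B - Bᵀ`, so few eigenvalues are nonreal and close
to the line. As the limit measure lives on the line, the nonreal mass tends to zero.

The jumps `w x` are therefore limits of relative multiplicities, which agree on conjugates. If `w x
≠ 0`, then `x` is an eigenvalue of some normal integer matrix, and all conjugates of a real
eigenvalue of such a matrix are real (`Matrix.im_eq_zero_of_isConjRoot`).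

For the continuous part, give each real eigenvalue of `B k` the excess of its relative multiplicity
over `w`, cut off at zero. This is a conjugation invariant measure on finitely many totally real
integers, hence a multiple of a convex combination of the `μ_α`. Dominated convergence shows that
its distribution functions converge pointwise to the diffuse part, and monotonicity makes the
convergence uniform (`tendstoUniformly_of_monotone_of_continuous`). -/

/-- The product of the nonzero complex roots of a monic integer polynomial has modulus at
least one. -/
theorem Polynomial.one_le_norm_prod_filter_ne_zero_aroots {P : ℤ[X]} (hP : P.Monic) :
    1 ≤ ‖((P.aroots ℂ).filter (· ≠ 0)).prod‖ := by
  -- Dividing out the power of `X` removes exactly the zero roots; what remains has product `±Q(0)`,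
  -- a nonzero integer.
  obtain ⟨Q, hPQ, hQ⟩ := exists_eq_pow_rootMultiplicity_mul_and_not_dvd P hP.ne_zero 0
  rw [C_0, sub_zero] at hPQ hQ
  have hQm : Q.Monic := by
    rw [hPQ] at hP
    exact (monic_X_pow _).of_mul_monic_left hP
  have hQ0 : Q.coeff 0 ≠ 0 := fun h => hQ (X_dvd_iff.mpr h)
  have h0 : (0 : ℂ) ∉ Q.aroots ℂ := by
    rw [mem_aroots]
    rintro ⟨-, h⟩
    rw [← coeff_zero_eq_aeval_zero'] at h
    exact hQ0 (by simpa using h)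
  have hroots : (P.aroots ℂ).filter (· ≠ 0) = Q.aroots ℂ := by
    have hne : (X ^ rootMultiplicity 0 P * Q : ℤ[X]) ≠ 0 := hPQ ▸ hP.ne_zero
    rw [hPQ, aroots_mul hne, aroots_X_pow, Multiset.filter_add]
    have h1 : (rootMultiplicity 0 P • ({0} : Multiset ℂ)).filter (· ≠ 0) = 0 := by
      rw [Multiset.filter_eq_nil]
      intro a ha
      have := Multiset.mem_of_mem_nsmul ha
      simpa using this
    rw [h1, zero_add, Multiset.filter_eq_self]
    rintro a ha rfl
    exact h0 ha
  rw [hroots]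
  have hs := (IsAlgClosed.splits (Q.map (algebraMap ℤ ℂ))).coeff_zero_eq_prod_roots_of_monic
    (hQm.map _)
  have h2 : ‖(Q.aroots ℂ).prod‖ = ‖((Q.coeff 0 : ℤ) : ℂ)‖ := by
    rw [coeff_map] at hs
    have := congrArg norm hs
    rw [norm_mul, norm_pow, norm_neg, norm_one, one_pow, one_mul] at this
    exact this.symm
  rw [h2, Complex.norm_intCast]
  exact_mod_cast Int.one_le_abs hQ0

/-- The multiset of pairs of distinct elements of `R`, with multiplicities. -/
def Multiset.offDiagPairs {α : Type*} [DecidableEq α] (R : Multiset α) : Multiset (α × α) :=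
  (R ×ˢ R).filter fun p => p.1 ≠ p.2

theorem Multiset.offDiagPairs_map {α β : Type*} [DecidableEq α] [DecidableEq β] {f : α → β}
    (hf : Function.Injective f) (R : Multiset α) :
    (R.map f).offDiagPairs = R.offDiagPairs.map (Prod.map f f) := by
  have h : R.map f ×ˢ R.map f = (R ×ˢ R).map (Prod.map f f) := by
    simp only [SProd.sprod, Multiset.product, Multiset.map_bind, Multiset.bind_map,
      Multiset.map_map, Function.comp_def, Prod.map_apply]
  rw [offDiagPairs, h, Multiset.filter_map, offDiagPairs]
  congr 1
  apply Multiset.filter_congr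
  simp [hf.eq_iff]

/-- The product of the differences of distinct complex roots (with multiplicities) of a monic
integer polynomial has modulus at least one. -/
theorem Polynomial.one_le_norm_prod_offDiagPairs_aroots {P : ℤ[X]} (hP : P.Monic) :
    1 ≤ ‖((P.aroots ℂ).offDiagPairs.map fun p => p.1 - p.2).prod‖ := by
  classical
  let K := (P.map (algebraMap ℤ ℚ)).SplittingField
  let R : Multiset K := P.aroots K
  have hsplit : (P.map (algebraMap ℤ K)).Splits := by
    have := SplittingField.splits (P.map (algebraMap ℤ ℚ))
    rwa [Polynomial.map_map, ← IsScalarTower.algebraMap_eq] at this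
  let φ : K →ₐ[ℚ] ℂ := SplittingField.lift _ (IsAlgClosed.splits _)
  have hφ : P.aroots ℂ = R.map φ := by
    have := hsplit.roots_map (φ : K →+* ℂ)
    rw [Polynomial.map_map, RingHom.ext_int ((φ : K →+* ℂ).comp _) (algebraMap ℤ ℂ)] at this
    exact this
  let x : K := (R.offDiagPairs.map fun p => p.1 - p.2).prod
  have hx : ((P.aroots ℂ).offDiagPairs.map fun p => p.1 - p.2).prod = φ x := by
    rw [hφ, Multiset.offDiagPairs_map (f := φ) φ.toRingHom.injective, Multiset.map_map, map_multiset_prod,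
      Multiset.map_map]
    congr 1
    apply Multiset.map_congr rfl
    simp
  have hx0 : x ≠ 0 := by
    apply Multiset.prod_ne_zero
    simp only [Multiset.offDiagPairs, Multiset.mem_map, Multiset.mem_filter, not_exists, not_and]
    rintro q ⟨-, h⟩ h'
    exact h (sub_eq_zero.mp h')
  -- An automorphism permutes the roots with their multiplicities. The pairs are ordered, so both `a
  -- - b` and `b - a` occur and no sign appears.
  have hfix : ∀ σ : Gal(K/ℚ), σ x = x := by
    intro σ
    have hσ : R.map σ = R := by
      have := hsplit.roots_map ((σ : K →ₐ[ℚ] K) : K →+* K)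
      rw [Polynomial.map_map,
        RingHom.ext_int (((σ : K →ₐ[ℚ] K) : K →+* K).comp _) (algebraMap ℤ K)] at this
      exact this.symm
    have h1 : σ x = ((R.map σ).offDiagPairs.map fun p => p.1 - p.2).prod := by
      rw [Multiset.offDiagPairs_map σ.injective, Multiset.map_map, map_multiset_prod,
        Multiset.map_map]
      congr 1
      apply Multiset.map_congr rfl
      simp
    rw [h1, hσ]
  -- The `ℚ`-algebra structure on `K` may be found along another path than the one of the splitting
  -- field; such structures are unique.
  have : Normal ℚ K := by
    convert (Normal.of_isSplittingField (P.map (algebraMap ℤ ℚ)) :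
      @Normal ℚ (P.map (algebraMap ℤ ℚ)).SplittingField _ _ (SplittingField.instAlgebra _))
    exact Subsingleton.elim _ _
  have : IsGalois ℚ K := IsGalois.mk
  obtain ⟨r, hr⟩ := (IsGalois.mem_range_algebraMap_iff_fixed x).mpr hfix
  have hint : IsIntegral ℤ x := by
    apply IsIntegral.multiset_prod
    simp only [Multiset.offDiagPairs, Multiset.mem_map, Multiset.mem_filter, Multiset.mem_product]
    rintro _ ⟨q, ⟨⟨h1, h2⟩, -⟩, rfl⟩
    have hR : ∀ y ∈ R, IsIntegral ℤ y := by
      intro y hy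
      refine ⟨P, hP, ?_⟩
      have := (mem_aroots.mp hy).2
      rwa [aeval_def] at this
    exact (hR _ h1).sub (hR _ h2)
  rw [← hr, isIntegral_algebraMap_iff (algebraMap ℚ K).injective] at hint
  obtain ⟨m, hm⟩ := IsIntegrallyClosed.isIntegral_iff.mp hint
  have hm0 : m ≠ 0 := by
    rintro rfl
    apply hx0
    rw [← hr, ← hm]; simp
  rw [hx, ← hr, ← hm]
  simp only [algebraMap_int_eq, eq_intCast, map_intCast, Complex.norm_intCast]
  exact_mod_cast Int.one_le_abs hm0

/-- Conjugate numbers have the same multiplicity as roots of a monic integer polynomial. -/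
theorem IsConjRoot.count_aroots_eq {P : ℤ[X]} {x y : ℂ} (h : IsConjRoot ℚ x y)
    (hP : P.Monic) : (P.aroots ℂ).count x = (P.aroots ℂ).count y := by
  classical
  by_cases hx : IsIntegral ℚ x
  swap
  · have hy : ¬ IsIntegral ℚ y := fun hy => hx (h.symm.isIntegral hy)
    have aux : ∀ z : ℂ, ¬ IsIntegral ℚ z → (P.aroots ℂ).count z = 0 := by
      intro z hz
      refine Multiset.count_eq_zero.mpr fun hmem => hz ?_
      have : IsIntegral ℤ z := ⟨P, hP, by
        have := (mem_aroots.mp hmem).2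
        rwa [aeval_def] at this⟩
      exact this.tower_top
    rw [aux x hx, aux y hy]
  set p : ℚ[X] := P.map (algebraMap ℤ ℚ) with hp
  have hp0 : p ≠ 0 := (hP.map _).ne_zero
  have hroots : P.aroots ℂ = (p.map (algebraMap ℚ ℂ)).roots := by
    rw [hp, Polynomial.map_map]; rfl
  have hirr := minpoly.irreducible hx
  have hfin : FiniteMultiplicity (minpoly ℚ x) p :=
    FiniteMultiplicity.of_not_isUnit hirr.not_isUnit hp0
  -- Every conjugate is a simple root of the minimal polynomial and no root of `Q`, so its
  -- multiplicity is the exponent of the minimal polynomial in `p`.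
  obtain ⟨Q, hQ, hdvd⟩ := hfin.exists_eq_pow_mul_and_not_dvd
  have aux : ∀ z : ℂ, minpoly ℚ z = minpoly ℚ x → IsIntegral ℚ z →
      (P.aroots ℂ).count z = multiplicity (minpoly ℚ x) p := by
    intro z hz hzi
    have hne : (p.map (algebraMap ℚ ℂ)) ≠ 0 := by
      simpa using hp0
    rw [hroots, count_roots]
    rw [hQ] at hne
    conv_lhs => rw [hQ]
    rw [Polynomial.map_mul] at hne ⊢
    rw [rootMultiplicity_mul hne, Polynomial.map_pow, ← count_roots, roots_pow,
      Multiset.count_nsmul]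
    have h1 : (((minpoly ℚ x).map (algebraMap ℚ ℂ)).roots).count z = 1 := by
      apply Multiset.count_eq_one_of_mem
      · exact nodup_roots (hirr.separable.map)
      · rw [← hz]
        rw [mem_roots (by simpa using minpoly.ne_zero hzi)]
        simp [IsRoot, eval_map_algebraMap]
    have h2 : rootMultiplicity z (Q.map (algebraMap ℚ ℂ)) = 0 := by
      apply rootMultiplicity_eq_zero
      intro hroot
      apply hdvd
      rw [← hz]
      apply minpoly.dvd
      simpa [IsRoot, eval_map_algebraMap] using hroot
    rw [h1, h2]; simp
  rw [aux x rfl hx, aux y h.symm (h.isIntegral hx)]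

end

/-! ### Eigenvalues of normal integer matrices -/

section

open Polynomial

namespace Matrix

theorem star_map_intCast {n : Type*} (B : Matrix n n ℤ) :
    star (B.map (Int.cast : ℤ → ℂ)) = (Bᵀ).map (Int.cast : ℤ → ℂ) := by
  ext i j
  simp [Matrix.star_apply]

variable {n : Type*} [Fintype n] [DecidableEq n]

/-- Both sides are multiplicative in `p` and `p` splits, which leaves constants and factors `X - r`;
for the latter the identity is the characteristic polynomial evaluated at `r`, up to sign. -/
theorem det_aeval_eq_prod_roots_charpoly {K : Type*} [Field K] [IsAlgClosed K] (B : Matrix n n K)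
    (p : K[X]) : (aeval B p).det = (B.charpoly.roots.map fun z => p.eval z).prod := by
  classical
  have hcard : B.charpoly.roots.card = Fintype.card n := by
    rw [← (IsAlgClosed.splits B.charpoly).natDegree_eq_card_roots, B.charpoly_natDegree_eq_dim]
  have hX : ∀ r : K, (B - algebraMap K (Matrix n n K) r).det
      = (B.charpoly.roots.map fun z => z - r).prod := by
    intro r
    have h1 := B.eval_charpoly r
    rw [(IsAlgClosed.splits B.charpoly).eval_eq_prod_roots_of_monic B.charpoly_monic] at h1
    have h2 : B - algebraMap K (Matrix n n K) r = -(Matrix.scalar n r - B) := by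
      rw [neg_sub]; rfl
    rw [h2, det_neg, ← h1, ← hcard, ← Multiset.card_map (fun z => r - z),
      ← Multiset.prod_map_neg, Multiset.map_map]
    simp
  have hp := (IsAlgClosed.splits p).eq_prod_roots
  generalize p.roots = R at hp
  generalize p.leadingCoeff = c at hp
  subst hp
  induction R using Multiset.induction with
  | empty => simp [Matrix.algebraMap_eq_diagonal, hcard]
  | cons a R ih =>
    rw [Multiset.map_cons, Multiset.prod_cons, mul_left_comm, map_mul, det_mul, ih, map_sub,
      aeval_X, aeval_C, hX, ← Multiset.prod_map_mul]
    simp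

/-- Apply the determinant formula to the polynomial `t - p`, for each scalar `t`. -/
theorem charpoly_roots_aeval {K : Type*} [Field K] [IsAlgClosed K] (B : Matrix n n K)
    (p : K[X]) : (aeval B p).charpoly.roots = B.charpoly.roots.map fun z => p.eval z := by
  have h : (aeval B p).charpoly
      = ((B.charpoly.roots.map fun z => p.eval z).map fun a => X - C a).prod := by
    apply Polynomial.funext
    intro t
    have h1 : Matrix.scalar n t - aeval B p = aeval B (C t - p) := by
      rw [map_sub, aeval_C]; rfl
    rw [eval_charpoly, h1, det_aeval_eq_prod_roots_charpoly, Multiset.map_map,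
      eval_multiset_prod, Multiset.map_map]
    simp [Function.comp_def]
  rw [h, roots_multiset_prod_X_sub_C]

/-- The adjoint of a normal matrix is a polynomial in the matrix. -/
theorem exists_star_eq_aeval {B : Matrix n n ℂ} (hB : IsStarNormal B) :
    ∃ q : ℂ[X], star B = aeval B q ∧ ∀ z ∈ B.charpoly.roots, q.eval z = star z := by
  let Φ := toEuclideanCLM (𝕜 := ℂ) (n := n)
  have hspec : spectrum ℂ (Φ B) = spectrum ℂ B := AlgEquiv.spectrum_eq Φ B
  have hfin : (spectrum ℂ B).Finite := B.finite_spectrum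
  -- On the finite spectrum conjugation agrees with an interpolating polynomial, and the functional
  -- calculus of a normal element sees only values on the spectrum.
  let q := Lagrange.interpolate hfin.toFinset id (fun z : ℂ => star z)
  have hq : ∀ z ∈ spectrum ℂ B, q.eval z = star z := by
    intro z hz
    exact Lagrange.eval_interpolate_at_node _ (Set.injOn_id _) (hfin.mem_toFinset.mpr hz)
  have hn : IsStarNormal (Φ B) := hB.map Φ
  refine ⟨q, ?_, fun z hz => hq z ?_⟩
  · apply EquivLike.injective Φ
    have h1 : star (Φ B) = cfc (fun z : ℂ => star z) (Φ B) := by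
      rw [cfc_star (fun z : ℂ => z) (Φ B), cfc_id' ℂ (Φ B)]
    have h2 : cfc (fun z : ℂ => star z) (Φ B) = cfc (fun z => q.eval z) (Φ B) :=
      cfc_congr fun z hz => (hq z (hspec ▸ hz)).symm
    rw [map_star, h1, h2, cfc_polynomial q (Φ B)]
    exact aeval_algHom_apply Φ B q
  · rw [mem_spectrum_iff_isRoot_charpoly]
    exact (mem_roots'.mp hz).2

/-- Turns the uniform operator norm bound into a common disc for all eigenvalues, the form in which
the counting estimates use it. -/
theorem norm_le_of_mem_charpoly_roots {B : Matrix n n ℂ} {z : ℂ} (hz : z ∈ B.charpoly.roots) :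
    ‖z‖ ≤ ‖toEuclideanCLM (𝕜 := ℂ) B‖ := by
  have h : z ∈ spectrum ℂ (toEuclideanCLM (𝕜 := ℂ) B) := by
    rw [AlgEquiv.spectrum_eq, mem_spectrum_iff_isRoot_charpoly]
    exact (mem_roots'.mp hz).2
  have : Nontrivial (EuclideanSpace ℂ n →L[ℂ] EuclideanSpace ℂ n) := by
    by_contra hc
    rw [not_nontrivial_iff_subsingleton] at hc
    simp at h
  have : NormOneClass (EuclideanSpace ℂ n →L[ℂ] EuclideanSpace ℂ n) := inferInstance
  exact spectrum.norm_le_norm_of_mem h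

theorem mulVec_aeval_of_eigenvector {K : Type*} [Field K] {B : Matrix n n K} {z : K} {v : n → K}
    (hv : B *ᵥ v = z • v) (q : K[X]) : aeval B q *ᵥ v = q.eval z • v := by
  induction q using Polynomial.induction_on' with
  | add p q hp hq => rw [map_add, add_mulVec, hp, hq, eval_add, add_smul]
  | monomial k a =>
    have hk : B ^ k *ᵥ v = z ^ k • v := by
      induction k with
      | zero => simp
      | succ k ih => rw [pow_succ, ← mulVec_mulVec, hv, mulVec_smul, ih, smul_smul, pow_succ']
    rw [aeval_monomial, eval_monomial, ← mulVec_mulVec, hk, Matrix.algebraMap_eq_diagonal]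
    ext i
    simp [mulVec_diagonal, mul_assoc]

/-- The adjoint is a polynomial in `B`, so it keeps the eigenvectors of `B`. -/
theorem star_mulVec_of_eigenvector {B : Matrix n n ℂ} (hB : IsStarNormal B) {z : ℂ} {v : n → ℂ}
    (hv0 : v ≠ 0) (hv : B *ᵥ v = z • v) : star B *ᵥ v = star z • v := by
  obtain ⟨q, hq, hqz⟩ := exists_star_eq_aeval hB
  rw [hq, mulVec_aeval_of_eigenvector hv, hqz]
  rw [mem_roots B.charpoly_monic.ne_zero, IsRoot, eval_charpoly, ← exists_mulVec_eq_zero_iff]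
  refine ⟨v, hv0, ?_⟩
  rw [sub_mulVec, hv]
  ext i
  simp [Matrix.scalar_apply]

section IntegerMatrix

variable {B : Matrix n n ℤ}

theorem charpoly_map_intCast_roots (B : Matrix n n ℤ) :
    (B.map (Int.cast : ℤ → ℂ)).charpoly.roots = B.charpoly.aroots ℂ := by
  have := B.charpoly_map (algebraMap ℤ ℂ)
  simp only [algebraMap_int_eq, Int.coe_castRingHom] at this
  rw [this]
  rfl

/-- Complex conjugation commutes with Galois conjugation on the eigenvalues of a normal integer
matrix; in particular every conjugate of a real eigenvalue is real. -/
theorem im_eq_zero_of_isConjRoot (hB : IsStarNormal (B.map (Int.cast : ℤ → ℂ))) {x z : ℂ}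
    (hx : x ∈ B.charpoly.aroots ℂ) (hx0 : x.im = 0) (hxz : IsConjRoot ℚ x z) : z.im = 0 := by
  have hint : IsIntegral ℚ x := by
    have h : IsIntegral ℤ x := ⟨B.charpoly, B.charpoly_monic, by
      have := (mem_aroots.mp hx).2
      rwa [aeval_def] at this⟩
    exact h.tower_top
  have : Fact (Irreducible (minpoly ℚ x)) := ⟨minpoly.irreducible hint⟩
  -- Over `ℚ(x)` a single eigenvector `v` serves both embeddings. Under `φ`, where `g` becomes the
  -- real number `x`, it follows that `Bᵀ v = g v`; this descends to `K` by injectivity, and read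
  -- under `ψ` it says that `z` equals its complex conjugate.
  let K := AdjoinRoot (minpoly ℚ x)
  let g : K := AdjoinRoot.root _
  let emb : ∀ y : ℂ, IsConjRoot ℚ x y → ∃ φ : K →+* ℂ, φ g = y := by
    intro y hy
    refine ⟨AdjoinRoot.lift (algebraMap ℚ ℂ) y ?_, AdjoinRoot.lift_root _⟩
    rw [← aeval_def]
    exact hy.aeval_eq_zero
  obtain ⟨φ, hφ⟩ := emb x .refl
  obtain ⟨ψ, hψ⟩ := emb z hxz
  have hmap : ∀ (χ : K →+* ℂ) (A : Matrix n n ℤ),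
      (A.map (Int.cast : ℤ → K)).map χ = A.map (Int.cast : ℤ → ℂ) := by
    intro χ A; ext i j; exact map_intCast χ _
  have hmv : ∀ (χ : K →+* ℂ) (A : Matrix n n ℤ) (v : n → K),
      A.map (Int.cast : ℤ → ℂ) *ᵥ (χ ∘ v) = χ ∘ (A.map (Int.cast : ℤ → K) *ᵥ v) := by
    intro χ A v
    ext i
    rw [← hmap χ]
    exact (χ.map_mulVec _ _ _).symm
  obtain ⟨v, hv0, hv⟩ : ∃ v : n → K, v ≠ 0 ∧ B.map (Int.cast : ℤ → K) *ᵥ v = g • v := by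
    have hdet : (B.map (Int.cast : ℤ → K)).charpoly.eval g = 0 := by
      apply φ.injective
      rw [map_zero]
      have h1 : (B.map (Int.cast : ℤ → K)).charpoly = B.charpoly.map (algebraMap ℤ K) :=
        B.charpoly_map (algebraMap ℤ K)
      rw [h1, eval_map_algebraMap]
      have h2 := (mem_aroots.mp hx).2
      rw [← hφ] at h2
      have h3 := hom_eval₂ B.charpoly (algebraMap ℤ K) φ g
      rw [aeval_def, h3, RingHom.ext_int (φ.comp _) (algebraMap ℤ ℂ)]
      exact h2
    rw [eval_charpoly, ← exists_mulVec_eq_zero_iff] at hdet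
    obtain ⟨v, hv0, hv⟩ := hdet
    refine ⟨v, hv0, ?_⟩
    rw [sub_mulVec, sub_eq_zero] at hv
    rw [← hv]
    ext i
    simp [Matrix.scalar_apply, mulVec_diagonal]
  have hne : ∀ χ : K →+* ℂ, χ ∘ v ≠ 0 := by
    intro χ h
    apply hv0
    ext i
    apply χ.injective
    simpa using congrFun h i
  have heig : ∀ χ : K →+* ℂ, B.map (Int.cast : ℤ → ℂ) *ᵥ (χ ∘ v) = χ g • (χ ∘ v) := by
    intro χ
    rw [hmv, hv]
    ext i
    simp
  have hstar : ∀ χ : K →+* ℂ, χ ∘ ((Bᵀ).map (Int.cast : ℤ → K) *ᵥ v) = star (χ g) • (χ ∘ v) := by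
    intro χ
    rw [← hmv, ← star_map_intCast]
    exact star_mulVec_of_eigenvector hB (hne χ) (heig χ)
  have hT : (Bᵀ).map (Int.cast : ℤ → K) *ᵥ v = g • v := by
    have h1 := hstar φ
    have h2 : star (φ g) = φ g := by
      rw [hφ]; exact Complex.conj_eq_iff_im.mpr hx0
    rw [h2] at h1
    ext i
    apply φ.injective
    simpa using congrFun h1 i
  have h3 := hstar ψ
  rw [hT] at h3
  obtain ⟨i, hi⟩ := Function.ne_iff.mp (hne ψ)
  have h4 := congrFun h3 i
  simp only [Function.comp_apply, Pi.smul_apply, smul_eq_mul, map_mul] at h4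
  have h5 := mul_right_cancel₀ hi h4
  rw [hψ] at h5
  exact Complex.conj_eq_iff_im.mp h5.symm

/-- The product of the numbers `z - conj z`, over the nonreal eigenvalues `z` of a normal integer
matrix, has modulus at least one. -/
theorem one_le_norm_prod_sub_conj (hB : IsStarNormal (B.map (Int.cast : ℤ → ℂ))) :
    1 ≤ ‖(((B.charpoly.aroots ℂ).filter fun z => z.im ≠ 0).map fun z => z - star z).prod‖ := by
  obtain ⟨q, hq, hqz⟩ := exists_star_eq_aeval hB
  have h := one_le_norm_prod_filter_ne_zero_aroots (B - Bᵀ).charpoly_monic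
  have h1 : (B - Bᵀ).map (Int.cast : ℤ → ℂ) = aeval (B.map (Int.cast : ℤ → ℂ)) (X - q) := by
    rw [map_sub, aeval_X, ← hq, star_map_intCast]
    ext i j
    simp
  have h2 : (B - Bᵀ).charpoly.aroots ℂ = (B.charpoly.aroots ℂ).map fun z => z - star z := by
    rw [← charpoly_map_intCast_roots, h1, charpoly_roots_aeval, charpoly_map_intCast_roots]
    apply Multiset.map_congr rfl
    intro z hz
    rw [eval_sub, eval_X, hqz]
    rwa [charpoly_map_intCast_roots]
  rw [h2, Multiset.filter_map] at h
  convert h using 5 with z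
  have : z - star z = 0 ↔ z.im = 0 := by
    rw [sub_eq_zero, eq_comm]; exact Complex.conj_eq_iff_im
  exact (not_congr this).symm

end IntegerMatrix

end Matrix

end

/-! ### Logarithmic counting estimates for roots -/

section

open Polynomial

theorem Multiset.prod_le_pow_card_of_nonneg {S : Multiset ℝ} {K : ℝ}
    (hS : ∀ s ∈ S, 0 ≤ s ∧ s ≤ K) : S.prod ≤ K ^ S.card := by
  induction S using Multiset.induction with
  | empty => simp
  | cons a S ih =>
    have ha := hS a (mem_cons_self a S)
    have hS' := fun s hs => hS s (mem_cons_of_mem hs)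
    rw [prod_cons, card_cons, pow_succ']
    exact mul_le_mul ha.2 (ih hS') (prod_nonneg fun s hs => (hS' s hs).1) (ha.1.trans ha.2)

/-- With `m` factors below `δ`, the product is at most `δ ^ m * K ^ N`; it is also at least one, so
take logarithms. -/
theorem Multiset.card_filter_lt_mul_log_le {S : Multiset ℝ} {K δ : ℝ} {N : ℕ}
    (hS : ∀ s ∈ S, 0 ≤ s ∧ s ≤ K) (hK : 1 ≤ K) (hprod : 1 ≤ S.prod) (hcard : S.card ≤ N)
    (hδ : 0 < δ) :
    ((S.filter (· < δ)).card : ℝ) * Real.log δ⁻¹ ≤ N * Real.log K := by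
  have h1 : (S.filter (· < δ)).prod ≤ δ ^ (S.filter (· < δ)).card :=
    prod_le_pow_card_of_nonneg fun x hx =>
      ⟨(hS x (Multiset.mem_filter.mp hx).1).1, (Multiset.mem_filter.mp hx).2.le⟩
  have h2 : (S.filter fun s => ¬ s < δ).prod ≤ K ^ (S.filter fun s => ¬ s < δ).card :=
    prod_le_pow_card_of_nonneg fun x hx => hS x (Multiset.mem_filter.mp hx).1
  have h3 : (S.filter fun s => ¬ s < δ).card ≤ N :=
    (Multiset.card_le_card (Multiset.filter_le _ _)).trans hcard
  have h4 : 1 ≤ δ ^ (S.filter (· < δ)).card * K ^ N := by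
    rw [← Multiset.prod_filter_mul_prod_filter_not (· < δ)] at hprod
    refine hprod.trans (mul_le_mul h1 (h2.trans (pow_le_pow_right₀ hK h3)) ?_ (by positivity))
    apply Multiset.prod_nonneg
    intro x hx; exact (hS x (Multiset.mem_filter.mp hx).1).1
  have h5 := Real.log_nonneg h4
  rw [Real.log_mul (by positivity) (by positivity), Real.log_pow, Real.log_pow] at h5
  rw [Real.log_inv]
  linarith

/-- An element `a` lies in `T.count a` diagonal pairs as first entry, so bounded multiplicities
leave many pairs of distinct elements. -/
theorem Multiset.sq_card_le_card_offDiagPairs_add {α : Type*} [DecidableEq α] {T : Multiset α}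
    {m : ℝ} (hm : ∀ a ∈ T, (T.count a : ℝ) ≤ m) :
    (T.card : ℝ) ^ 2 ≤ T.offDiagPairs.card + T.card * m := by
  have h1 : (T.card : ℝ) ^ 2 = T.offDiagPairs.card
      + ((T ×ˢ T).filter fun p => ¬ p.1 ≠ p.2).card := by
    rw [offDiagPairs, ← Nat.cast_add, ← Multiset.card_add, Multiset.filter_add_not,
      Multiset.card_product]
    push_cast; ring
  have h2 : ((T ×ˢ T).filter fun p => ¬ p.1 ≠ p.2).card = (T.map fun a => T.count a).sum := by
    -- Only the first factor is varied, so the counts in `T` stay fixed during the induction.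
    have : ∀ S : Multiset α, ((S ×ˢ T).filter fun p => ¬ p.1 ≠ p.2).card
        = (S.map fun a => T.count a).sum := by
      intro S
      induction S using Multiset.induction with
      | empty => simp
      | cons a S ih =>
        rw [Multiset.cons_product, Multiset.filter_add, Multiset.card_add, ih, Multiset.map_cons,
          Multiset.sum_cons, Multiset.filter_map, Multiset.card_map, Multiset.count,
          Multiset.countP_eq_card_filter]
        simp
    exact this T
  have h3 : (((T.map fun a => T.count a).sum : ℕ) : ℝ) ≤ T.card * m := by
    rw [Nat.cast_multiset_sum, Multiset.map_map, ← nsmul_eq_mul]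
    have := Multiset.sum_le_card_nsmul (T.map ((fun n : ℕ => (n : ℝ)) ∘ fun a => T.count a)) m (by
      simpa using hm)
    simpa using this
  rw [h1, h2]
  linarith

theorem Multiset.offDiagPairs_mono {α : Type*} [DecidableEq α] {S T : Multiset α} (h : S ≤ T) :
    S.offDiagPairs ≤ T.offDiagPairs := by
  obtain ⟨U, rfl⟩ := Multiset.le_iff_exists_add.mp h
  apply Multiset.filter_le_filter
  rw [Multiset.add_product, Multiset.product_add, add_assoc]
  exact Multiset.le_add_right _ _

namespace Polynomial

/-- Few pairs of distinct roots of a monic integer polynomial can be close to each other. -/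
theorem card_offDiagPairs_mul_log_le {P : ℤ[X]} (hP : P.Monic) {C : ℝ} (hC : 1 ≤ C)
    (hroots : ∀ z ∈ P.aroots ℂ, ‖z‖ ≤ C) {δ : ℝ} (hδ : 0 < δ) (hδ1 : δ ≤ 1) {T : Multiset ℂ}
    (hT : T ≤ P.aroots ℂ) (hclose : ∀ y ∈ T, ∀ z ∈ T, ‖y - z‖ < δ) :
    (T.offDiagPairs.card : ℝ) * Real.log δ⁻¹ ≤ (P.aroots ℂ).card ^ 2 * Real.log (2 * C) := by
  set R := P.aroots ℂ
  have hprod := one_le_norm_prod_offDiagPairs_aroots hP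
  rw [← normHom_apply, map_multiset_prod, Multiset.map_map] at hprod
  have h1 := Multiset.card_filter_lt_mul_log_le (K := 2 * C) (N := R.card ^ 2) (δ := δ)
    ?_ (by linarith) hprod ?_ hδ
  · push_cast at h1
    refine le_trans (mul_le_mul_of_nonneg_right ?_ (Real.log_nonneg ?_)) h1
    · rw [Multiset.filter_map, Multiset.card_map]
      have h2 : T.offDiagPairs ≤ R.offDiagPairs.filter
          ((fun x => x < δ) ∘ (⇑normHom ∘ fun p : ℂ × ℂ => p.1 - p.2)) := by
        rw [Multiset.le_filter]
        refine ⟨Multiset.offDiagPairs_mono hT, ?_⟩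
        intro p hp
        have := (Multiset.mem_product.mp (Multiset.mem_filter.mp hp).1)
        exact hclose _ this.1 _ this.2
      exact_mod_cast Multiset.card_le_card h2
    · exact (one_le_inv₀ hδ).mpr hδ1
  · intro s hs
    obtain ⟨p, hp, rfl⟩ := Multiset.mem_map.mp hs
    have := (Multiset.mem_product.mp (Multiset.mem_filter.mp hp).1)
    refine ⟨norm_nonneg (p.1 - p.2), (norm_sub_le p.1 p.2).trans ?_⟩
    linarith [hroots _ this.1, hroots _ this.2]
  · rw [Multiset.card_map]
    refine (Multiset.card_le_card (Multiset.filter_le _ _)).trans ?_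
    rw [Multiset.card_product, sq]

theorem isIntegral_of_mem_aroots {P : ℤ[X]} (hP : P.Monic) {y : ℂ} (hy : y ∈ P.aroots ℂ) :
    IsIntegral ℤ y :=
  ⟨P, hP, by simpa [aeval_def] using (mem_aroots.mp hy).2⟩

/-- The degree of a root of multiplicity `m` of a monic integer polynomial of degree `n` is at
most `n / m`. -/
theorem natDegree_minpoly_mul_count_le {P : ℤ[X]} (hP : P.Monic) {y : ℂ} (hy : y ∈ P.aroots ℂ) :
    (minpoly ℚ y).natDegree * (P.aroots ℂ).count y ≤ (P.aroots ℂ).card := by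
  classical
  have hint : IsIntegral ℚ y := (isIntegral_of_mem_aroots hP hy).tower_top
  have hcard : ((minpoly ℚ y).aroots ℂ).toFinset.card = (minpoly ℚ y).natDegree := by
    rw [Multiset.toFinset_card_of_nodup (nodup_roots (minpoly.irreducible hint).separable.map),
      ← (IsAlgClosed.splits ((minpoly ℚ y).map (algebraMap ℚ ℂ))).natDegree_eq_card_roots,
      natDegree_map]
  have hconj : ∀ z ∈ ((minpoly ℚ y).aroots ℂ).toFinset,
      (P.aroots ℂ).count z = (P.aroots ℂ).count y := by
    intro z hz
    rw [Multiset.mem_toFinset, ← isConjRoot_iff_mem_minpoly_aroots hint] at hz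
    exact (hz.count_aroots_eq hP).symm
  rw [← hcard, ← smul_eq_mul, ← Finset.sum_const, ← Finset.sum_congr rfl hconj]
  rw [← Multiset.toFinset_sum_count_eq (P.aroots ℂ)]
  apply Finset.sum_le_sum_of_subset
  intro z hz
  rw [Multiset.mem_toFinset, ← Multiset.count_pos, hconj z hz, Multiset.count_pos]
  exact hy

/-- Only finitely many complex numbers carry at least the proportion `η` of the roots of a monic
integer polynomial with all roots in a given disc. -/
theorem finite_setOf_le_count_aroots {η : ℝ} (hη : 0 < η) (C : ℝ) :
    {y : ℂ | ∃ P : ℤ[X], P.Monic ∧ (∀ z ∈ P.aroots ℂ, ‖z‖ ≤ C) ∧ y ∈ P.aroots ℂ ∧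
      η * (P.aroots ℂ).card ≤ (P.aroots ℂ).count y}.Finite := by
  classical
  -- All conjugates of `y` share its proportion of at least `η`, so `D` bounds the degree. `K`
  -- bounds the coefficients of the minimal polynomial, whose roots lie in the disc as they are
  -- roots of `P`.
  set D : ℕ := ⌊η⁻¹⌋₊
  set K : ℕ := ⌈max C 1 ^ D * (2 : ℝ) ^ D⌉₊
  refine (bUnion_roots_finite (algebraMap ℤ ℂ) D (Set.finite_Icc (-K : ℤ) K)).subset ?_
  rintro y ⟨P, hP, hbd, hy, hcount⟩
  have hintZ := isIntegral_of_mem_aroots hP hy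
  have hint : IsIntegral ℚ y := hintZ.tower_top
  have hmin := minpoly.isIntegrallyClosed_eq_field_fractions' ℚ hintZ
  have hdeg : (minpoly ℤ y).natDegree ≤ D := by
    have h1 := natDegree_minpoly_mul_count_le hP hy
    rw [hmin, (minpoly.monic hintZ).natDegree_map] at h1
    apply Nat.le_floor
    have hpos : (0 : ℝ) < (P.aroots ℂ).card := by
      exact_mod_cast Multiset.card_pos_iff_exists_mem.mpr ⟨y, hy⟩
    have h2 : ((minpoly ℤ y).natDegree : ℝ) * (P.aroots ℂ).count y ≤ (P.aroots ℂ).card := by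
      exact_mod_cast h1
    have h3 : ((minpoly ℤ y).natDegree : ℝ) * (η * (P.aroots ℂ).card) ≤ (P.aroots ℂ).card :=
      (mul_le_mul_of_nonneg_left hcount (Nat.cast_nonneg _)).trans h2
    rw [← one_div, le_div_iff₀ hη]
    by_contra! hlt
    nlinarith
  have hroots : ∀ z ∈ ((minpoly ℤ y).map (algebraMap ℤ ℂ)).roots, ‖z‖ ≤ C := by
    intro z hz
    apply hbd
    have hz' : IsConjRoot ℚ y z := by
      rw [isConjRoot_iff_mem_minpoly_aroots hint, hmin, mem_aroots]
      have := mem_aroots.mp hz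
      refine ⟨?_, ?_⟩
      · exact ((minpoly.monic hintZ).map _).ne_zero
      · rw [aeval_map_algebraMap]; exact this.2
    rw [← Multiset.count_pos, ← hz'.count_aroots_eq hP, Multiset.count_pos]
    exact hy
  simp only [Set.mem_iUnion]
  refine ⟨minpoly ℤ y, ⟨hdeg, fun i => ?_⟩, ?_⟩
  · have h1 := coeff_bdd_of_roots_le (algebraMap ℤ ℂ) (minpoly.monic hintZ)
      (IsAlgClosed.splits _) hdeg hroots i
    rw [coeff_map, eq_intCast, Complex.norm_intCast] at h1
    have h2 : |(((minpoly ℤ y).coeff i : ℤ) : ℝ)| ≤ K := by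
      refine h1.trans (le_trans ?_ (Nat.le_ceil _))
      gcongr
      exact_mod_cast Nat.choose_le_two_pow D (D / 2)
    rw [Set.mem_Icc, ← abs_le]
    exact_mod_cast h2
  · rw [Finset.mem_coe, Multiset.mem_toFinset, mem_roots ((minpoly.monic hintZ).map _).ne_zero]
    rw [IsRoot, eval_map_algebraMap, minpoly.aeval]

theorem exists_pos_log_inv_gt (A : ℝ) : ∃ δ : ℝ, 0 < δ ∧ δ ≤ 1 ∧ A < Real.log δ⁻¹ := by
  refine ⟨Real.exp (-(|A| + 1)), Real.exp_pos _, ?_, ?_⟩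
  · rw [Real.exp_le_one_iff]; linarith [abs_nonneg A]
  · rw [← Real.exp_neg, Real.log_exp]; linarith [le_abs_self A]

/-- The roots of monic integer polynomials with all roots in a given disc cannot accumulate at a
point `x`, uniformly in the polynomial. -/
theorem exists_card_filter_ball_le (x : ℂ) {η : ℝ} (hη : 0 < η) (C : ℝ) :
    ∃ δ : ℝ, 0 < δ ∧ ∀ P : ℤ[X], P.Monic → (∀ z ∈ P.aroots ℂ, ‖z‖ ≤ C) →
      (((P.aroots ℂ).filter fun z => dist z x < δ ∧ z ≠ x).card : ℝ)
        ≤ η * (P.aroots ℂ).card := by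
  wlog hC : 1 ≤ C generalizing C
  · obtain ⟨δ, hδ, h⟩ := this 1 le_rfl
    exact ⟨δ, hδ, fun P hP hb => h P hP fun z hz => (hb z hz).trans (not_le.mp hC).le⟩
  -- The point `x` itself may have high multiplicity; the other such points are finitely many and
  -- stay outside the ball of radius `δ₁`.
  have hfin := (finite_setOf_le_count_aroots (half_pos hη) C).subset
    (Set.sdiff_subset (t := {x}))
  obtain ⟨δ₁, hδ₁, hball⟩ := Metric.mem_nhds_iff.mp
    (hfin.isClosed.isOpen_compl.mem_nhds (x := x) (by simp))
  obtain ⟨δ₂, hδ₂, hδ₂1, hlog⟩ := exists_pos_log_inv_gt (2 * Real.log (2 * C) / η ^ 2)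
  -- With radius at most `δ₂ / 2`, any two points of the ball are closer than `δ₂`.
  refine ⟨min δ₁ (δ₂ / 2), by positivity, fun P hP hb => ?_⟩
  set R := P.aroots ℂ
  set T := R.filter fun z => dist z x < min δ₁ (δ₂ / 2) ∧ z ≠ x
  have hTR : T ≤ R := Multiset.filter_le _ _
  have hcount : ∀ a ∈ T, (T.count a : ℝ) ≤ η / 2 * R.card := by
    intro a ha
    obtain ⟨haR, haball, hax⟩ := Multiset.mem_filter.mp ha
    by_contra! hlt
    have h1 : (T.count a : ℝ) ≤ R.count a := by exact_mod_cast Multiset.count_le_of_le a hTR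
    have h2 := hball (Metric.ball_subset_ball (min_le_left _ _) haball)
    exact h2 ⟨⟨P, hP, hb, haR, (hlt.trans_le h1).le⟩, hax⟩
  have hoff := card_offDiagPairs_mul_log_le hP hC hb hδ₂ hδ₂1 hTR (by
    intro y hy z hz
    have hy' := (Multiset.mem_filter.mp hy).2.1
    have hz' := (Multiset.mem_filter.mp hz).2.1
    rw [← dist_eq_norm]
    have := dist_triangle_right y z x
    have := min_le_right δ₁ (δ₂ / 2)
    linarith)
  have hsq := Multiset.sq_card_le_card_offDiagPairs_add hcount
  by_contra! hlt
  have hL : 0 < Real.log δ₂⁻¹ := lt_of_le_of_lt (by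
    have := Real.log_nonneg (show 1 ≤ 2 * C by linarith)
    positivity) hlog
  rw [div_lt_iff₀ (by positivity)] at hlog
  have hR0 : (0 : ℝ) ≤ R.card := Nat.cast_nonneg _
  have hTcard : (T.card : ℝ) ≤ R.card := by exact_mod_cast Multiset.card_le_card hTR
  have hRpos : (0 : ℝ) < R.card := by
    rcases hR0.eq_or_lt with h | h
    · rw [← h] at hTcard hlt; linarith
    · exact h
  set t : ℝ := (T.card : ℝ)
  set r : ℝ := (R.card : ℝ)
  set o : ℝ := (T.offDiagPairs.card : ℝ)
  set l := Real.log δ₂⁻¹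
  -- Multiplicities are at most `η r / 2 < t / 2`, so the diagonal uses at most half of the `t ^ 2`
  -- pairs.
  have h1 : t ^ 2 / 2 ≤ o := by
    have := mul_le_mul_of_nonneg_left hlt.le (Nat.cast_nonneg T.card : 0 ≤ t)
    linarith
  have h2 : (η * r) ^ 2 < t ^ 2 := by
    apply pow_lt_pow_left₀ hlt (by positivity) two_ne_zero
  have h3 : (η * r) ^ 2 / 2 * l < r ^ 2 * Real.log (2 * C) := by
    refine lt_of_lt_of_le ?_ hoff
    exact mul_lt_mul_of_pos_right (by linarith) hL
  have h4 : r ^ 2 * (2 * Real.log (2 * C)) < r ^ 2 * (l * η ^ 2) :=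
    mul_lt_mul_of_pos_left hlog (by positivity)
  linarith

end Polynomial

/-- Few eigenvalues of a normal integer matrix are nonreal and close to the real line. -/
theorem Matrix.card_filter_im_lt_mul_log_le {n : Type*} [Fintype n] [DecidableEq n]
    {B : Matrix n n ℤ} (hB : IsStarNormal (B.map (Int.cast : ℤ → ℂ))) {C : ℝ} (hC : 1 ≤ C)
    (hroots : ∀ z ∈ B.charpoly.aroots ℂ, ‖z‖ ≤ C) {δ : ℝ} (hδ : 0 < δ) :
    (((B.charpoly.aroots ℂ).filter fun z => z.im ≠ 0 ∧ 2 * |z.im| < δ).card : ℝ)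
      * Real.log δ⁻¹ ≤ (B.charpoly.aroots ℂ).card * Real.log (2 * C) := by
  have hprod := one_le_norm_prod_sub_conj hB
  rw [← normHom_apply, map_multiset_prod, Multiset.map_map] at hprod
  have hnorm : ∀ z : ℂ, ‖z - star z‖ = 2 * |z.im| := by
    intro z
    have : z - star z = ((2 * z.im : ℝ) : ℂ) * Complex.I := Complex.sub_conj z
    rw [this, norm_mul, Complex.norm_I, mul_one, Complex.norm_real, Real.norm_eq_abs, abs_mul,
      abs_two]
  have h1 := Multiset.card_filter_lt_mul_log_le (K := 2 * C) (N := (B.charpoly.aroots ℂ).card)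
    (δ := δ) ?_ (by linarith) hprod ?_ hδ
  · convert h1 using 3
    rw [Multiset.filter_map, Multiset.card_map, Multiset.filter_filter]
    congr 1
    apply Multiset.filter_congr
    intro z _
    simp only [Function.comp_apply, normHom_apply, hnorm]
    exact and_comm
  · intro s hs
    obtain ⟨z, hz, rfl⟩ := Multiset.mem_map.mp hs
    refine ⟨norm_nonneg (z - star z), ?_⟩
    have := hroots z (Multiset.mem_filter.mp hz).1
    simp only [Function.comp_apply, normHom_apply, hnorm]
    linarith [Complex.abs_im_le_norm z]
  · rw [Multiset.card_map]
    exact Multiset.card_le_card (Multiset.filter_le _ _)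

end

/-! ### Spectral measures and distribution functions of operators -/

noncomputable section

namespace FiniteVN

variable {H : Type*} [NormedAddCommGroup H] [InnerProductSpace ℂ H] [CompleteSpace H]
  {M : VonNeumannAlgebra H}

section SpectralMeasure

variable (τ : Trace M) (a : M.toStarSubalgebra) (ha : IsStarNormal (a : H →L[ℂ] H))

theorem Trace.integral_spectralMeasure_compactlySupported (f : C_c(ℂ, ℝ)) :
    ∫ z, f z ∂(τ.spectralMeasure a ha)
      = (τ.toFun (functionalCalculus a fun z => ((f z : ℝ) : ℂ))).re :=
  RealRMK.integral_rieszMeasure (τ.spectralFunctional a ha) f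

instance : IsFiniteMeasureOnCompacts (τ.spectralMeasure a ha) := by
  unfold Trace.spectralMeasure; infer_instance

theorem functionalCalculus_congr {f g : ℂ → ℂ}
    (h : ∀ z ∈ spectrum ℂ (a : H →L[ℂ] H), f z = g z) :
    functionalCalculus a f = functionalCalculus a g :=
  Subtype.ext (cfc_congr h)

/-- By inner regularity compact subsets suffice; a bump function equal to one there and vanishing on
the spectrum has functional calculus zero. -/
theorem Trace.spectralMeasure_compl_spectrum :
    τ.spectralMeasure a ha (spectrum ℂ (a : H →L[ℂ] H))ᶜ = 0 := by
  set U := (spectrum ℂ (a : H →L[ℂ] H))ᶜ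
  have hU : IsOpen U := (spectrum.isClosed _).isOpen_compl
  have : (τ.spectralMeasure a ha).Regular := by unfold Trace.spectralMeasure; infer_instance
  rw [hU.measure_eq_iSup_isCompact]
  simp only [ENNReal.iSup_eq_zero]
  intro K hKU hK
  obtain ⟨f, hf1, hf0, hfc, hf⟩ := exists_continuous_one_zero_of_isCompact hK hU.isClosed_compl
    (Set.disjoint_compl_right_iff_subset.mpr hKU)
  let F : C_c(ℂ, ℝ) := ⟨f, hfc⟩
  have hint := τ.integral_spectralMeasure_compactlySupported a ha F
  have h0 : functionalCalculus a (fun z => ((F z : ℝ) : ℂ)) = 0 := by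
    rw [functionalCalculus_congr a (g := fun _ => 0)]
    · exact Subtype.ext (cfc_const_zero ℂ _)
    · intro z hz
      have : f z = 0 := hf0 (by simpa [U] using hz)
      exact_mod_cast this
  rw [h0, map_zero, Complex.zero_re] at hint
  have hFint : Integrable F (τ.spectralMeasure a ha) :=
    F.continuous.integrable_of_hasCompactSupport hfc
  rw [integral_eq_zero_iff_of_nonneg (f := F) (fun z => (hf z).1) hFint] at hint
  refine measure_mono_null (fun z hz => ?_) hint
  have : f z = 1 := hf1 hz
  change ¬ f z = 0
  rw [this]; exact one_ne_zero

theorem Trace.ae_mem_spectrum :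
    ∀ᵐ z ∂(τ.spectralMeasure a ha), z ∈ spectrum ℂ (a : H →L[ℂ] H) :=
  τ.spectralMeasure_compl_spectrum a ha

/-- Multiplying by a cutoff equal to one on the spectrum changes neither side. -/
theorem Trace.integral_spectralMeasure {f : ℂ → ℝ} (hf : Continuous f) :
    ∫ z, f z ∂(τ.spectralMeasure a ha)
      = (τ.toFun (functionalCalculus a fun z => ((f z : ℝ) : ℂ))).re := by
  obtain ⟨χ, hχ1, -, hχc, -⟩ := exists_continuous_one_zero_of_isCompact
    (spectrum.isCompact (𝕜 := ℂ) (a : H →L[ℂ] H)) isClosed_empty (Set.disjoint_empty _)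
  let F : C_c(ℂ, ℝ) := ⟨⟨fun z => f z * χ z, by fun_prop⟩, hχc.mul_left⟩
  have hF : ∀ z ∈ spectrum ℂ (a : H →L[ℂ] H), F z = f z := by
    intro z hz
    have : χ z = 1 := hχ1 hz
    change f z * χ z = f z
    rw [this, mul_one]
  have h1 := τ.integral_spectralMeasure_compactlySupported a ha F
  rw [functionalCalculus_congr a (fun z hz => congrArg Complex.ofReal (hF z hz))] at h1
  rw [← h1]
  apply integral_congr_ae
  filter_upwards [τ.ae_mem_spectrum a ha] with z hz using (hF z hz).symm

instance : IsProbabilityMeasure (τ.spectralMeasure a ha) := by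
  set μ := τ.spectralMeasure a ha
  have hfin : μ Set.univ < ∞ := by
    rw [← Set.union_compl_self (spectrum ℂ (a : H →L[ℂ] H))]
    refine (measure_union_le _ _).trans_lt ?_
    rw [τ.spectralMeasure_compl_spectrum a ha, add_zero]
    exact (spectrum.isCompact (𝕜 := ℂ) (a : H →L[ℂ] H)).measure_lt_top
  have : IsFiniteMeasure μ := ⟨hfin⟩
  have h := τ.integral_spectralMeasure a ha (f := fun _ => 1) continuous_const
  have h1 : functionalCalculus a (fun _ => ((1 : ℝ) : ℂ)) = 1 := by
    apply Subtype.ext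
    change cfc (fun _ => ((1 : ℝ) : ℂ)) (a : H →L[ℂ] H) = 1
    rw [Complex.ofReal_one, cfc_const_one ℂ (a : H →L[ℂ] H)]
  rw [h1, τ.map_one] at h
  simp only [integral_const, smul_eq_mul, mul_one, Complex.one_re] at h
  exact ⟨by rw [← ENNReal.toReal_eq_one_iff]; exact h⟩

end SpectralMeasure

section Projection

/-- The functions `f / (f + ε)` of a self-adjoint operator `A` have the range projection of `f(A)`
as their least upper bound. -/
theorem isLUB_cfc_div_add (A : H →L[ℂ] H) {f : ℝ → ℝ} (hf : Continuous f)
    (hf0 : ∀ s, 0 ≤ f s) :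
    IsLUB (Set.range fun n : ℕ => cfc (fun s => f s / (f s + 1 / ((n : ℝ) + 1))) A)
      (LinearMap.range (cfc f A).toLinearMap).topologicalClosure.starProjection := by
  set T := cfc f A
  set K := (LinearMap.range T.toLinearMap).topologicalClosure
  set P := K.starProjection
  set ε : ℕ → ℝ := fun n => 1 / ((n : ℝ) + 1)
  have hε : ∀ n, 0 < ε n := fun n => Nat.one_div_pos_of_nat
  set G : ℕ → H →L[ℂ] H := fun n => cfc (fun s => f s / (f s + ε n)) A
  have hpos : ∀ n s, 0 < f s + ε n := fun n s => add_pos_of_nonneg_of_pos (hf0 s) (hε n)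
  have hgc : ∀ n, Continuous fun s => f s / (f s + ε n) :=
    fun n => hf.div₀ (hf.add continuous_const) fun s => (hpos n s).ne'
  have hTK : ∀ x, T x ∈ K := fun x => Submodule.le_topologicalClosure _ ⟨x, rfl⟩
  have hPfix : ∀ y ∈ K, P y = y := fun y hy => Submodule.starProjection_eq_self_iff.mpr hy
  have hPsa : star P = P := isSelfAdjoint_starProjection K
  have hGsa : ∀ n, star (G n) = G n := fun n => (cfc_predicate _ A : IsSelfAdjoint (G n))
  -- `G n` factors through `T` on the left, so its range lies in `K`.
  have hPG : ∀ n, P * G n = G n := by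
    intro n
    have h1 : G n = T * cfc (fun s => (f s + ε n)⁻¹) A := by
      have hhc : Continuous fun s => (f s + ε n)⁻¹ :=
        (hf.add continuous_const).inv₀ fun s => (hpos n s).ne'
      rw [← cfc_mul f _ A hf.continuousOn hhc.continuousOn]
      rfl
    ext x
    rw [h1]
    exact hPfix _ (hTK _)
  have hGP : ∀ n, G n * P = G n := by
    intro n
    have := congrArg star (hPG n)
    rwa [star_mul, hPsa, hGsa] at this
  have hG1 : ∀ n, G n ≤ 1 := by
    intro n
    refine cfc_le_one _ A fun s _ => ?_
    rw [div_le_one (hpos n s)]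
    linarith [hε n]
  have hG0 : ∀ n, 0 ≤ G n := fun n => cfc_nonneg fun s _ => div_nonneg (hf0 s) (hpos n s).le
  have hPP : P * P = P := K.isIdempotentElem_starProjection
  have hGnorm : ∀ n, ‖G n‖ ≤ 1 := by
    intro n
    refine norm_cfc_le zero_le_one fun s _ => ?_
    rw [Real.norm_of_nonneg (div_nonneg (hf0 s) (hpos n s).le), div_le_one (hpos n s)]
    linarith [hε n]
  have hGT : ∀ n, ‖G n * T - T‖ ≤ ε n := by
    intro n
    have h1 : G n * T - T = cfc (fun s => f s / (f s + ε n) * f s - f s) A := by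
      rw [cfc_sub (fun s => f s / (f s + ε n) * f s) f A ((hgc n).mul hf).continuousOn
        hf.continuousOn, cfc_mul _ f A (hgc n).continuousOn hf.continuousOn]
    rw [h1]
    refine norm_cfc_le (hε n).le fun s _ => ?_
    have h2 : f s / (f s + ε n) * f s - f s = -(f s / (f s + ε n) * ε n) := by
      have := (hpos n s).ne'
      field_simp
      ring
    rw [h2, norm_neg, Real.norm_of_nonneg (mul_nonneg (div_nonneg (hf0 s) (hpos n s).le) (hε n).le)]
    apply mul_le_of_le_one_left (hε n).le
    rw [div_le_one (hpos n s)]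
    linarith [hε n]
  have hεlim : Tendsto ε atTop (𝓝 0) := tendsto_one_div_add_atTop_nhds_zero_nat
  -- On the range of `T` this follows from `‖G n * T - T‖ ≤ ε n`; the bound `‖G n‖ ≤ 1` extends it
  -- to the closure. Since `G n * P = G n`, the sequence converges strongly to `P`, and upper bounds
  -- pass to the strong limit.
  have hlimK : ∀ y ∈ K, Tendsto (fun n => G n y) atTop (𝓝 y) := by
    intro y hy
    rw [Metric.tendsto_atTop]
    intro η hη
    obtain ⟨_, ⟨x, rfl⟩, hx⟩ := Metric.mem_closure_iff.mp hy (η / 3) (by positivity)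
    have hlim : Tendsto (fun n => ε n * ‖x‖) atTop (𝓝 0) := by
      simpa using hεlim.mul_const ‖x‖
    obtain ⟨N, hN⟩ := (hlim.eventually_lt_const (show 0 < η / 3 by positivity)).exists_forall_of_atTop
    refine ⟨N, fun n hn => ?_⟩
    have h1 : dist (G n y) (G n (T x)) ≤ dist y (T x) := by
      rw [dist_eq_norm, dist_eq_norm, ← map_sub]
      exact ((G n).le_of_opNorm_le (hGnorm n) _).trans (one_mul _).le
    have h2 : dist (G n (T x)) (T x) ≤ ε n * ‖x‖ := by
      rw [dist_eq_norm]
      exact (G n * T - T).le_of_opNorm_le (hGT n) x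
    have h3 : dist (T x) y < η / 3 := by rw [dist_comm]; exact hx
    have h4 : dist y (T x) < η / 3 := hx
    linarith [dist_triangle4 (G n y) (G n (T x)) (T x) y, hN n hn]
  have hlim : ∀ x, Tendsto (fun n => G n x) atTop (𝓝 (P x)) := by
    intro x
    have := hlimK (P x) (K.starProjection_apply_mem x)
    refine this.congr fun n => ?_
    exact congrArg (fun R : H →L[ℂ] H => R x) (hGP n)
  constructor
  · rintro _ ⟨n, rfl⟩
    have h1 : 0 ≤ star P * (1 - G n) * P := star_left_conjugate_nonneg (sub_nonneg.mpr (hG1 n)) P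
    rw [hPsa, mul_sub, mul_one, hPG, sub_mul, hPP, hGP] at h1
    exact sub_nonneg.mp h1
  · intro S hS
    have hS' : ∀ n, (S - G n).IsPositive := fun n =>
      (ContinuousLinearMap.le_def _ _).mp (hS ⟨n, rfl⟩)
    have hSsa : IsSelfAdjoint S := by
      have := (hS' 0).isSelfAdjoint.add (show IsSelfAdjoint (G 0) from hGsa 0)
      simpa using this
    rw [ContinuousLinearMap.le_def, ContinuousLinearMap.isPositive_def]
    refine ⟨(ContinuousLinearMap.isSelfAdjoint_iff_isSymmetric.mp
      (hSsa.sub (show IsSelfAdjoint P from hPsa))), fun x => ?_⟩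
    have hl : Tendsto (fun n => (S - G n).reApplyInnerSelf x) atTop
        (𝓝 ((S - P).reApplyInnerSelf x)) := by
      simp only [ContinuousLinearMap.reApplyInnerSelf_apply, _root_.sub_apply]
      exact (RCLike.continuous_re.tendsto _).comp
        ((tendsto_const_nhds.sub (hlim x)).inner tendsto_const_nhds)
    exact ge_of_tendsto' hl fun n =>
      ((ContinuousLinearMap.isPositive_def).mp (hS' n)).2 x

end Projection

/-- The distribution function of a self-adjoint operator, in terms of its spectral measure. -/
theorem Trace.distributionFunction_eq (τ : Trace M) (A : M.toStarSubalgebra)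
    (hA : IsSelfAdjoint (A : H →L[ℂ] H)) (ha : IsStarNormal (A : H →L[ℂ] H)) (t : ℝ) :
    τ.distributionFunction A t = (τ.spectralMeasure A ha).real {z | z.re < t} := by
  set μ := τ.spectralMeasure A ha
  set f : ℝ → ℝ := fun s => max (t - s) 0
  have hf : Continuous f := by fun_prop
  have hf0 : ∀ s, 0 ≤ f s := fun s => le_max_right _ _
  set g : ℕ → ℝ → ℝ := fun n s => f s / (f s + 1 / ((n : ℝ) + 1))
  have hpos : ∀ (n : ℕ) s, 0 < f s + 1 / ((n : ℝ) + 1) :=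
    fun n s => add_pos_of_nonneg_of_pos (hf0 s) Nat.one_div_pos_of_nat
  have hgc : ∀ n, Continuous (g n) :=
    fun n => hf.div₀ (hf.add continuous_const) fun s => (hpos n s).ne'
  have hgmono : Monotone g := by
    intro m n hmn s
    have : 1 / ((n : ℝ) + 1) ≤ 1 / ((m : ℝ) + 1) := Nat.one_div_le_one_div hmn
    exact div_le_div_of_nonneg_left (hf0 s) (hpos n s) (by linarith)
  have hg0 : ∀ n s, 0 ≤ g n s := fun n s => div_nonneg (hf0 s) (hpos n s).le
  have hg1 : ∀ n s, g n s ≤ 1 := by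
    intro n s
    rw [div_le_one (hpos n s)]
    have : 0 < 1 / ((n : ℝ) + 1) := Nat.one_div_pos_of_nat
    linarith
  set y : ℕ → M.toStarSubalgebra := fun n => ⟨cfc (g n) (A : H →L[ℂ] H), cfc_real_mem A _⟩
  have hymono : ∀ m n, m ≤ n → (y m : H →L[ℂ] H) ≤ (y n : H →L[ℂ] H) := fun m n hmn =>
    cfc_mono (fun s _ => hgmono hmn s) (hgc m).continuousOn (hgc n).continuousOn
  -- Normality gives the trace of the projection as the limit of the traces of `g n (A)`. These are
  -- integrals of `g n`, which increase to the indicator of the half-line.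
  have hlub := τ.normal (Set.range y)
    ⟨spectralProjection (A : H →L[ℂ] H) t, spectralProjection_mem A t⟩ (Set.range_nonempty y)
    (by rintro _ ⟨n, rfl⟩; exact cfc_nonneg fun s _ => hg0 n s)
    (by
      rintro _ ⟨m, rfl⟩ _ ⟨n, rfl⟩
      exact ⟨y (max m n), ⟨_, rfl⟩, hymono _ _ (le_max_left _ _), hymono _ _ (le_max_right _ _)⟩)
    (by
      rw [← Set.range_comp]
      exact isLUB_cfc_div_add (A : H →L[ℂ] H) hf hf0)
  rw [← Set.range_comp] at hlub
  have hval : ∀ n, (τ.toFun (y n)).re = ∫ z, g n z.re ∂μ := by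
    intro n
    rw [τ.integral_spectralMeasure A ha (f := fun z => g n z.re)
      ((hgc n).comp Complex.continuous_re)]
    congr 2
    exact Subtype.ext (cfc_real_eq_complex (g n) hA)
  have hmono : Monotone fun n => (τ.toFun (y n)).re := by
    intro m n hmn
    change (τ.toFun (y m)).re ≤ (τ.toFun (y n)).re
    have := τ.nonneg (y n - y m) (sub_nonneg.mpr (hymono m n hmn))
    rw [map_sub] at this
    have := (Complex.le_def.mp this).1
    simpa using this
  have hlim1 := tendsto_atTop_isLUB hmono hlub
  have hlim2 : Tendsto (fun n => ∫ z, g n z.re ∂μ) atTop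
      (𝓝 (∫ z, ({z : ℂ | z.re < t}.indicator 1 z : ℝ) ∂μ)) := by
    refine tendsto_integral_of_dominated_convergence (fun _ => 1)
      (fun n => ((hgc n).comp Complex.continuous_re).aestronglyMeasurable) (integrable_const _)
      (fun n => Eventually.of_forall fun z => ?_) (Eventually.of_forall fun z => ?_)
    · rw [Real.norm_of_nonneg (hg0 _ _)]; exact hg1 _ _
    · by_cases hz : z.re < t
      · rw [Set.indicator_of_mem (show z ∈ {z : ℂ | z.re < t} from hz)]
        have hfz : 0 < f z.re := lt_max_of_lt_left (sub_pos.mpr hz)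
        have : Tendsto (fun n : ℕ => f z.re / (f z.re + 1 / ((n : ℝ) + 1))) atTop
            (𝓝 (f z.re / (f z.re + 0))) :=
          tendsto_const_nhds.div (tendsto_const_nhds.add tendsto_one_div_add_atTop_nhds_zero_nat)
            (by simpa using hfz.ne')
        rwa [add_zero, div_self hfz.ne'] at this
      · rw [Set.indicator_of_notMem (show z ∉ {z : ℂ | z.re < t} from hz)]
        have : f z.re = 0 := max_eq_right (sub_nonpos.mpr (not_lt.mp hz))
        simp [g, this]
  rw [integral_indicator_one (measurableSet_lt Complex.measurable_re measurable_const)] at hlim2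
  simp only [hval] at hlim1
  exact tendsto_nhds_unique hlim1 hlim2

end FiniteVN

end

/-! ### Weak limits, atoms, uniform convergence and convex combinations -/

noncomputable section

section Portmanteau

variable {Ω : Type*} [MeasurableSpace Ω] [TopologicalSpace Ω] [OpensMeasurableSpace Ω]
  [HasOuterApproxClosed Ω] {μs : ℕ → Measure Ω} [∀ k, IsProbabilityMeasure (μs k)] {μ : Measure Ω}
  [IsProbabilityMeasure μ]

theorem MeasureTheory.eventually_measureReal_lt_of_isClosed
    (h : ∀ f : Ω →ᵇ ℝ, Tendsto (fun k => ∫ z, f z ∂(μs k)) atTop (𝓝 (∫ z, f z ∂μ)))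
    {F : Set Ω} (hF : IsClosed F) {r : ℝ} (hr : μ.real F < r) : ∀ᶠ k in atTop, (μs k).real F < r := by
  have hlim : Tendsto (β := ProbabilityMeasure Ω) (fun k => ⟨μs k, inferInstance⟩) atTop
      (𝓝 ⟨μ, inferInstance⟩) := ProbabilityMeasure.tendsto_iff_forall_integral_tendsto.mpr h
  have h1 := ProbabilityMeasure.limsup_measure_closed_le_of_tendsto hlim hF
  simp only [ProbabilityMeasure.coe_mk] at h1
  have hr0 : 0 ≤ r := measureReal_nonneg.trans hr.le
  have h2 : μ F < ENNReal.ofReal r := (ENNReal.lt_ofReal_iff_toReal_lt (measure_ne_top μ F)).mpr hr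
  filter_upwards [eventually_lt_of_limsup_lt (h1.trans_lt h2)] with k hk
  exact (ENNReal.lt_ofReal_iff_toReal_lt (measure_ne_top _ F)).mp hk

theorem MeasureTheory.eventually_lt_measureReal_of_isOpen
    (h : ∀ f : Ω →ᵇ ℝ, Tendsto (fun k => ∫ z, f z ∂(μs k)) atTop (𝓝 (∫ z, f z ∂μ)))
    {G : Set Ω} (hG : IsOpen G) {r : ℝ} (hr : r < μ.real G) :
    ∀ᶠ k in atTop, r < (μs k).real G := by
  have hc := probReal_compl_eq_one_sub (μ := μ) hG.measurableSet
  filter_upwards [eventually_measureReal_lt_of_isClosed h hG.isClosed_compl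
    (show μ.real Gᶜ < 1 - r by linarith)] with k hk
  have := probReal_compl_eq_one_sub (μ := μs k) hG.measurableSet
  linarith

end Portmanteau

section Atoms

variable (μ : Measure ℝ) [IsFiniteMeasure μ]

theorem MeasureTheory.Measure.countable_setOf_measure_singleton_ne_zero :
    {x : ℝ | μ {x} ≠ 0}.Countable := by
  have := Measure.countable_meas_pos_of_disjoint_iUnion (μ := μ) (As := fun x : ℝ => {x})
    (fun x => measurableSet_singleton x) (fun x y hxy => by simpa [Function.onFun] using hxy)
  simpa [pos_iff_ne_zero] using this

/-- The diffuse part of a finite measure on the real line. -/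
def MeasureTheory.Measure.diffusePart : Measure ℝ := μ.restrict {x | μ {x} ≠ 0}ᶜ

instance : IsFiniteMeasure μ.diffusePart := by
  unfold Measure.diffusePart; infer_instance

instance : NullSingletonClass μ.diffusePart := by
  refine ⟨fun x => ?_⟩
  rw [Measure.diffusePart, Measure.restrict_apply (measurableSet_singleton x)]
  by_cases hx : μ {x} = 0
  · exact measure_mono_null Set.inter_subset_left hx
  · convert measure_empty (μ := μ)
    rw [Set.singleton_inter_eq_empty]
    simpa using hx

/-- The set of atoms is countable, so the point masses in `I` add up to the measure of `I`
intersected with it. -/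
theorem MeasureTheory.Measure.hasSum_indicator_singleton {I : Set ℝ} (hI : MeasurableSet I) :
    HasSum (I.indicator fun x => μ.real {x}) (μ.real I - μ.diffusePart.real I) := by
  set J : Set ℝ := {x | μ {x} ≠ 0}
  have hJ : J.Countable := μ.countable_setOf_measure_singleton_ne_zero
  have hIJ : (I ∩ J).Countable := hJ.mono Set.inter_subset_right
  have h1 : μ (I ∩ J) = ∑' x : ℝ, (I.indicator (fun x => μ {x})) x := by
    have := measure_biUnion (μ := μ) hIJ (f := fun x : ℝ => {x})
      (fun x _ y _ hxy => by simpa [Function.onFun] using hxy) (fun x _ => measurableSet_singleton x)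
    rw [Set.biUnion_of_singleton, tsum_subtype (I ∩ J) fun x => μ {x}] at this
    rw [this]
    congr 1
    ext x
    by_cases hxI : x ∈ I <;> by_cases hxJ : μ {x} = 0 <;> simp [Set.indicator, J, hxI, hxJ]
  have h2 : μ.real I - μ.diffusePart.real I = μ.real (I ∩ J) := by
    rw [Measure.diffusePart, measureReal_restrict_apply hI,
      ← measureReal_inter_add_sdiff (μ := μ) (s := I) hJ.measurableSet, Set.sdiff_eq]
    ring
  rw [h2, measureReal_def, h1, ENNReal.tsum_toReal_eq]
  · convert (ENNReal.summable_toReal (f := I.indicator fun x => μ {x}) ?_).hasSum using 1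
    · ext x
      by_cases hx : x ∈ I <;> simp [hx, measureReal_def]
    · rw [← h1]; exact measure_ne_top _ _
  · intro x
    by_cases hx : x ∈ I <;> simp [hx, measure_ne_top]

/-- Dominated convergence: the indicator of `x < s` is continuous in `s` at `t` unless `x = t`, a
null set. -/
theorem MeasureTheory.continuous_measureReal_Iio [NullSingletonClass μ] : Continuous fun t => μ.real (Set.Iio t) := by
  have h : ∀ t, μ.real (Set.Iio t) = ∫ x, (Set.Iio t).indicator 1 x ∂μ := fun t =>
    (integral_indicator_one measurableSet_Iio).symm
  simp only [h]
  rw [continuous_iff_continuousAt]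
  intro t
  refine continuousAt_of_dominated (bound := fun _ => 1)
    (Eventually.of_forall fun s => (measurable_one.indicator measurableSet_Iio).aestronglyMeasurable)
    (Eventually.of_forall fun s => Eventually.of_forall fun x => ?_) (integrable_const _) ?_
  · by_cases hx : x < s <;> simp [hx]
  · have hne : ∀ᵐ x ∂μ, x ≠ t := by
      rw [ae_iff]; simp
    filter_upwards [hne] with x hx
    rcases lt_or_gt_of_ne hx with h | h
    · refine (continuousAt_const (y := (1 : ℝ))).congr ?_
      filter_upwards [lt_mem_nhds h] with s hs
      rw [Set.indicator_of_mem (show x ∈ Set.Iio s from hs)]; rfl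
    · refine (continuousAt_const (y := (0 : ℝ))).congr ?_
      filter_upwards [gt_mem_nhds h] with s hs
      rw [Set.indicator_of_notMem (show x ∉ Set.Iio s from not_lt.mpr (le_of_lt hs))]

end Atoms

/-- Pólya's theorem: pointwise convergence of monotone functions to a continuous function which is
constant outside of a compact interval is uniform. -/
theorem tendstoUniformly_of_monotone_of_continuous {F : ℕ → ℝ → ℝ} {f : ℝ → ℝ} {a b c : ℝ}
    (hF : ∀ k, Monotone (F k)) (hF0 : ∀ k t, 0 ≤ F k t) (hFc : ∀ k t, F k t ≤ c)
    (hf : Continuous f) (ha : f a = 0) (hb : f b = c)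
    (hlim : ∀ t, Tendsto (fun k => F k t) atTop (𝓝 (f t))) : TendstoUniformly F f atTop := by
  have hfm : Monotone f := fun s t hst => le_of_tendsto_of_tendsto' (hlim s) (hlim t) fun k => hF k hst
  have hf0 : ∀ t, 0 ≤ f t := fun t => ge_of_tendsto' (hlim t) fun k => hF0 k t
  have hfc : ∀ t, f t ≤ c := fun t => le_of_tendsto' (hlim t) fun k => hFc k t
  have hloc : TendstoUniformlyOn F f atTop (Set.Icc a b) := by
    rw [← tendstoLocallyUniformlyOn_iff_tendstoUniformlyOn_of_compact isCompact_Icc,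
      Metric.tendstoLocallyUniformlyOn_iff]
    intro ε hε t _
    obtain ⟨δ, hδ, hball⟩ := Metric.continuous_iff.mp hf t (ε / 4) (by positivity)
    have hl : dist (f (t - δ / 2)) (f t) < ε / 4 := hball _ (by
      rw [Real.dist_eq, abs_lt]; constructor <;> linarith)
    have hr : dist (f (t + δ / 2)) (f t) < ε / 4 := hball _ (by
      rw [Real.dist_eq, abs_lt]; constructor <;> linarith)
    -- Monotonicity traps both functions between their values at the endpoints, so convergence at
    -- these two points suffices.
    refine ⟨Set.Icc (t - δ / 2) (t + δ / 2), mem_nhdsWithin_of_mem_nhds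
      (Icc_mem_nhds (by linarith) (by linarith)), ?_⟩
    filter_upwards [Metric.tendsto_nhds.mp (hlim (t - δ / 2)) (ε / 4) (by positivity),
      Metric.tendsto_nhds.mp (hlim (t + δ / 2)) (ε / 4) (by positivity)] with k h1 h2 s hs
    have m1 := hF k hs.1
    have m2 := hF k hs.2
    have m3 := hfm hs.1
    have m4 := hfm hs.2
    rw [Real.dist_eq, abs_lt] at *
    constructor <;> linarith
  rw [Metric.tendstoUniformly_iff]
  intro ε hε
  filter_upwards [Metric.tendstoUniformlyOn_iff.mp hloc ε hε,
    Metric.tendsto_nhds.mp (hlim a) ε hε, Metric.tendsto_nhds.mp (hlim b) ε hε] with k h1 h2 h3 t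
  rcases lt_or_ge t a with hta | hta
  · have m1 := hF k hta.le
    have m2 := hfm hta.le
    have m3 := hF0 k t
    have m4 := hf0 t
    rw [Real.dist_eq, abs_lt] at *
    constructor <;> linarith
  rcases lt_or_ge b t with htb | htb
  · have m1 := hF k htb.le
    have m2 := hfm htb.le
    have m3 := hFc k t
    have m4 := hfc t
    rw [Real.dist_eq, abs_lt] at *
    constructor <;> linarith
  exact h1 t ⟨hta, htb⟩

namespace FiniteVN

theorem isConjRoot_ofReal_iff {x y : ℝ} :
    IsConjRoot ℚ (x : ℂ) (y : ℂ) ↔ IsConjRoot ℚ x y :=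
  isConjRoot_algHom_iff (Complex.ofRealAm.restrictScalars ℚ)

/-- A totally real algebraic integer has as many real conjugates as its degree. -/
theorem IsTotallyRealInteger.card_aroots {x : ℝ} (hx : IsTotallyRealInteger x) :
    ((minpoly ℚ x).aroots ℝ).toFinset.card = (minpoly ℚ x).natDegree := by
  have hint : IsIntegral ℚ x := hx.1.tower_top
  have hintC : IsIntegral ℚ (x : ℂ) := hint.map (Complex.ofRealAm.restrictScalars ℚ)
  have hmin : minpoly ℚ (x : ℂ) = minpoly ℚ x :=
    minpoly.algHom_eq (Complex.ofRealAm.restrictScalars ℚ) Complex.ofReal_injective x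
  have hsep := (minpoly.irreducible hint).separable
  have hcard : ((minpoly ℚ x).aroots ℂ).toFinset.card = (minpoly ℚ x).natDegree := by
    rw [Multiset.toFinset_card_of_nodup (Polynomial.nodup_roots hsep.map),
      ← (IsAlgClosed.splits ((minpoly ℚ x).map (algebraMap ℚ ℂ))).natDegree_eq_card_roots,
      Polynomial.natDegree_map]
  rw [← hcard, ← Finset.card_image_of_injective _ Complex.ofReal_injective]
  congr 1
  ext z
  rw [Finset.mem_image, Multiset.mem_toFinset, ← hmin, ← isConjRoot_iff_mem_minpoly_aroots hintC]
  constructor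
  · rintro ⟨y, hy, rfl⟩
    rw [Multiset.mem_toFinset, hmin, ← isConjRoot_iff_mem_minpoly_aroots hint] at hy
    exact isConjRoot_ofReal_iff.mpr hy
  · intro hz
    have hre : ((z.re : ℝ) : ℂ) = z := Complex.ext rfl (by simpa using (hx.2 z hz).symm)
    refine ⟨z.re, ?_, hre⟩
    rw [Multiset.mem_toFinset, hmin, ← isConjRoot_iff_mem_minpoly_aroots hint,
      ← isConjRoot_ofReal_iff, hre]
    exact hz

theorem conjugateMeasure_real {x : ℝ} {I : Set ℝ} (hI : MeasurableSet I) :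
    (conjugateMeasure x).real I = ((minpoly ℚ x).natDegree : ℝ)⁻¹ *
      ∑ β ∈ ((minpoly ℚ x).aroots ℝ).toFinset, I.indicator 1 β := by
  rw [conjugateMeasure, measureReal_ennreal_smul_apply, measureReal_def,
    Measure.finsetSum_apply, ENNReal.toReal_sum]
  · simp only [Measure.dirac_apply' _ hI, ENNReal.toReal_inv, ENNReal.toReal_natCast]
    congr 1
    refine Finset.sum_congr rfl fun β _ => ?_
    by_cases hβ : β ∈ I <;> simp [hβ]
  · intro β _
    exact measure_ne_top _ _

instance (x : ℝ) : IsFiniteMeasure (conjugateMeasure x) := by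
  rw [conjugateMeasure]
  -- In degree zero the scalar is infinite, but then there are no roots and the sum is empty.
  by_cases h : ((minpoly ℚ x).aroots ℝ).toFinset = ∅
  · rw [h, Finset.sum_empty, smul_zero]; infer_instance
  · refine Measure.smul_finite _ (ENNReal.inv_ne_top.mpr ?_)
    rw [Nat.cast_ne_zero]
    intro h0
    apply h
    rw [Polynomial.eq_C_of_natDegree_eq_zero h0, Polynomial.aroots_C, Multiset.toFinset_zero]

/-- A conjugation invariant probability measure on finitely many totally real algebraic integers is
a convex combination of the measures `μ_α`. -/
theorem exists_isConvexCombination {S : Finset ℝ} {v : ℝ → ℝ} (hv : ∀ x, 0 ≤ v x)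
    (hS : ∀ x, v x ≠ 0 → x ∈ S) (htr : ∀ x ∈ S, IsTotallyRealInteger x)
    (hconj : ∀ x y, IsConjRoot ℚ x y → v y = v x) (hsum : ∑ x ∈ S, v x = 1) :
    ∃ ν : Measure ℝ, IsConvexCombination ν ∧
      ∀ I, MeasurableSet I → ν.real I = ∑ x ∈ S, I.indicator v x := by
  classical
  let e := S.equivFin
  refine ⟨∑ i, (v (e.symm i)).toNNReal • conjugateMeasure (e.symm i : S), ⟨S.card,
    fun i => (v (e.symm i)).toNNReal, fun i => (e.symm i : S), ?_, fun i => htr _ (e.symm i).2, rfl⟩, ?_⟩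
  · rw [Equiv.sum_comp e.symm fun x : S => (v x).toNNReal,
      Finset.sum_coe_sort S fun x => (v x).toNNReal, ← Real.toNNReal_sum_of_nonneg fun x _ => hv x,
      hsum, Real.toNNReal_one]
  · intro I hI
    rw [measureReal_def, Measure.finsetSum_apply, ENNReal.toReal_sum (by
      intro i _; exact measure_ne_top _ _)]
    have h1 : ∀ x : ℝ, (((v x).toNNReal • conjugateMeasure x) I).toReal
        = v x * (conjugateMeasure x).real I := by
      intro x
      rw [Measure.smul_apply, ENNReal.toReal_smul, NNReal.smul_def, Real.coe_toNNReal _ (hv x)]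
      rfl
    simp only [h1]
    rw [Equiv.sum_comp e.symm fun x : S => v x * (conjugateMeasure x).real I,
      Finset.sum_coe_sort S fun x => v x * (conjugateMeasure x).real I]
    have hmem : ∀ x ∈ S, ∀ y, y ∈ ((minpoly ℚ x).aroots ℝ).toFinset ↔ IsConjRoot ℚ x y := by
      intro x hx y
      rw [Multiset.mem_toFinset, ← isConjRoot_iff_mem_minpoly_aroots (htr x hx).1.tower_top]
    have hfilter : ∀ x ∈ S, v x ≠ 0 → ((minpoly ℚ x).aroots ℝ).toFinset
        = S.filter fun y => IsConjRoot ℚ x y := by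
      intro x hx hx0
      ext y
      rw [hmem x hx, Finset.mem_filter]
      refine ⟨fun h => ⟨hS y ?_, h⟩, fun h => h.2⟩
      rwa [hconj x y h]
    -- Spread `v x` over the conjugates of `x` as `v y / deg y`, then swap the sums: if `v y ≠ 0`,
    -- all `deg y` conjugates of `y` lie in `S`, and together they give back `v y`.
    have h2 : ∀ x ∈ S, v x * (conjugateMeasure x).real I
        = ∑ y ∈ S, if IsConjRoot ℚ x y then
            v y * ((minpoly ℚ y).natDegree : ℝ)⁻¹ * I.indicator 1 y else 0 := by
      intro x hx
      rw [← Finset.sum_filter]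
      have h3 : ∀ y ∈ S.filter fun y => IsConjRoot ℚ x y,
          v y * ((minpoly ℚ y).natDegree : ℝ)⁻¹ * I.indicator 1 y
            = v x * ((minpoly ℚ x).natDegree : ℝ)⁻¹ * I.indicator 1 y := by
        intro y hy
        have hy' := (Finset.mem_filter.mp hy).2
        rw [hconj x y hy', isConjRoot_def.mp hy']
      rw [Finset.sum_congr rfl h3]
      by_cases hx0 : v x = 0
      · simp [hx0]
      · rw [conjugateMeasure_real hI, hfilter x hx hx0, Finset.mul_sum, Finset.mul_sum]
        exact Finset.sum_congr rfl fun y _ => by ring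
    rw [Finset.sum_congr rfl h2, Finset.sum_comm]
    refine Finset.sum_congr rfl fun y hy => ?_
    rw [← Finset.sum_filter, Finset.sum_const, nsmul_eq_mul]
    by_cases hy0 : v y = 0
    · by_cases hyI : y ∈ I <;> simp [hy0, hyI]
    · have h4 : (S.filter fun x => IsConjRoot ℚ x y).card = (minpoly ℚ y).natDegree := by
        rw [← (htr y hy).card_aroots, hfilter y hy hy0]
        congr 1
        exact Finset.filter_congr fun x _ => IsConjRoot.comm
      have h5 : ((minpoly ℚ y).natDegree : ℝ) ≠ 0 := by
        have := minpoly.natDegree_pos (A := ℚ) ((htr y hy).1.tower_top : IsIntegral ℚ y)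
        positivity
      rw [h4]
      by_cases hyI : y ∈ I
      · simp [hyI]; field_simp
      · simp [hyI]

end FiniteVN

end

/-! ### Spectral measures of integer matrices and their limits -/

noncomputable section

theorem MeasureTheory.Measure.real_sum_map_dirac {R : Multiset ℂ} {p : ℂ → Prop} [DecidablePred p]
    (hp : MeasurableSet {z | p z}) :
    (R.map fun z => Measure.dirac z).sum {z | p z} = (R.filter p).card := by
  induction R using Multiset.induction with
  | empty => simp
  | cons a R ih =>
    rw [Multiset.map_cons, Multiset.sum_cons, Measure.add_apply, ih, Measure.dirac_apply' _ hp]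
    by_cases ha : p a
    · rw [Multiset.filter_cons_of_pos _ ha, Set.indicator_of_mem (show a ∈ {z | p z} from ha),
        Multiset.card_cons]
      push_cast
      exact add_comm _ _
    · rw [Multiset.filter_cons_of_neg _ ha, Set.indicator_of_notMem (show a ∉ {z | p z} from ha),
        zero_add]

namespace FiniteVN

/-- The spectral measure of an integer matrix. -/
def intSpectralMeasure {n : ℕ} (B : Matrix (Fin n) (Fin n) ℤ) : Measure ℂ :=
  matrixSpectralMeasure (B.map (Int.cast : ℤ → ℂ))

section Matrix

variable {n : ℕ} (B : Matrix (Fin n) (Fin n) ℤ)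

theorem card_aroots_charpoly : (B.charpoly.aroots ℂ).card = n := by
  rw [← (IsAlgClosed.splits (B.charpoly.map (algebraMap ℤ ℂ))).natDegree_eq_card_roots,
    B.charpoly_monic.natDegree_map, B.charpoly_natDegree_eq_dim, Fintype.card_fin]

theorem intSpectralMeasure_real {p : ℂ → Prop} [DecidablePred p] (hp : MeasurableSet {z | p z}) :
    (intSpectralMeasure B).real {z | p z}
      = ((B.charpoly.aroots ℂ).filter p).card / (B.charpoly.aroots ℂ).card := by
  rw [card_aroots_charpoly, intSpectralMeasure, matrixSpectralMeasure, measureReal_def,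
    Measure.smul_apply, Measure.real_sum_map_dirac hp, Matrix.charpoly_map_intCast_roots,
    smul_eq_mul, ENNReal.toReal_mul, ENNReal.toReal_inv, ENNReal.toReal_natCast,
    ENNReal.toReal_natCast, div_eq_inv_mul]

theorem isProbabilityMeasure_intSpectralMeasure (hn : 0 < n) :
    IsProbabilityMeasure (intSpectralMeasure B) := by
  refine ⟨?_⟩
  have h := Measure.real_sum_map_dirac (R := B.charpoly.aroots ℂ) (p := fun _ => True)
    (by simp)
  rw [intSpectralMeasure, matrixSpectralMeasure, Measure.smul_apply,
    Matrix.charpoly_map_intCast_roots]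
  simp only [Set.ofPred_true, Multiset.filter_true] at h
  rw [h, card_aroots_charpoly, smul_eq_mul, ENNReal.inv_mul_cancel (by simpa using hn.ne') (by simp)]

theorem intSpectralMeasure_real_singleton (x : ℂ) :
    (intSpectralMeasure B).real {x} = (B.charpoly.aroots ℂ).count x / (B.charpoly.aroots ℂ).card := by
  classical
  have h := intSpectralMeasure_real B (p := fun z => z = x) (measurableSet_singleton x)
  rw [Multiset.count, Multiset.countP_eq_card_filter]
  simp only [eq_comm (a := x)]
  exact h

theorem intSpectralMeasure_real_singleton_of_isConjRoot {x y : ℂ} (h : IsConjRoot ℚ x y) :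
    (intSpectralMeasure B).real {y} = (intSpectralMeasure B).real {x} := by
  rw [intSpectralMeasure_real_singleton, intSpectralMeasure_real_singleton,
    h.count_aroots_eq B.charpoly_monic]

theorem mem_aroots_of_intSpectralMeasure_real_ne_zero {x : ℂ}
    (h : (intSpectralMeasure B).real {x} ≠ 0) : x ∈ B.charpoly.aroots ℂ := by
  rw [intSpectralMeasure_real_singleton] at h
  rw [← Multiset.count_ne_zero]
  intro h0
  simp [h0] at h

theorem isTotallyRealInteger_of_mem_aroots {B : Matrix (Fin n) (Fin n) ℤ}
    (hB : IsStarNormal (B.map (Int.cast : ℤ → ℂ))) {x : ℝ}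
    (hx : (x : ℂ) ∈ B.charpoly.aroots ℂ) : IsTotallyRealInteger x := by
  refine ⟨?_, fun z hz => Matrix.im_eq_zero_of_isConjRoot hB hx (Complex.ofReal_im x) hz⟩
  have := Polynomial.isIntegral_of_mem_aroots B.charpoly_monic hx
  exact (isIntegral_algHom_iff (Complex.ofRealAm.restrictScalars ℤ) Complex.ofReal_injective).mp this

/-- The real eigenvalues of an integer matrix. -/
def realEigenvalues : Finset ℝ := ((B.charpoly.aroots ℂ).toFinset.filter fun z => z.im = 0).image Complex.re

theorem mem_realEigenvalues {x : ℝ} : x ∈ realEigenvalues B ↔ (x : ℂ) ∈ B.charpoly.aroots ℂ := by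
  rw [realEigenvalues, Finset.mem_image]
  constructor
  · rintro ⟨z, hz, rfl⟩
    obtain ⟨h1, h2⟩ := Finset.mem_filter.mp hz
    have : ((z.re : ℝ) : ℂ) = z := Complex.ext rfl h2.symm
    rw [this]
    exact Multiset.mem_toFinset.mp h1
  · intro h
    exact ⟨x, Finset.mem_filter.mpr ⟨Multiset.mem_toFinset.mpr h, Complex.ofReal_im x⟩,
      Complex.ofReal_re x⟩

theorem sum_realEigenvalues (hn : 0 < n) {I : Set ℝ} (hI : MeasurableSet I) :
    ∑ x ∈ realEigenvalues B, I.indicator (fun x => (intSpectralMeasure B).real {(x : ℂ)}) x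
      = (intSpectralMeasure B).real {z | z.im = 0 ∧ z.re ∈ I} := by
  classical
  have := isProbabilityMeasure_intSpectralMeasure B hn
  have hmeas : MeasurableSet {z : ℂ | z.im = 0 ∧ z.re ∈ I} :=
    (Complex.measurable_im (measurableSet_singleton 0)).inter (Complex.measurable_re hI)
  rw [intSpectralMeasure_real B hmeas, ← Multiset.toFinset_sum_count_eq, Nat.cast_sum,
    Finset.sum_div]
  refine (Finset.sum_indicator_eq_sum_filter (realEigenvalues B)
    (fun _ (x : ℝ) => (intSpectralMeasure B).real {(x : ℂ)}) (fun _ => I) id).trans ?_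
  refine Finset.sum_bij (fun x _ => (x : ℂ)) ?_ ?_ ?_ ?_
  · intro x hx
    obtain ⟨h1, h2⟩ := Finset.mem_filter.mp hx
    rw [Multiset.mem_toFinset, Multiset.mem_filter]
    exact ⟨(mem_realEigenvalues B).mp h1, Complex.ofReal_im x, by simpa using h2⟩
  · intro x _ y _ h
    exact Complex.ofReal_injective h
  · intro z hz
    rw [Multiset.mem_toFinset, Multiset.mem_filter] at hz
    have hre : ((z.re : ℝ) : ℂ) = z := Complex.ext rfl hz.2.1.symm
    refine ⟨z.re, Finset.mem_filter.mpr ⟨?_, hz.2.2⟩, hre⟩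
    rw [mem_realEigenvalues, hre]
    exact hz.1
  · intro x hx
    obtain ⟨h1, h2⟩ := Finset.mem_filter.mp hx
    rw [intSpectralMeasure_real_singleton, Multiset.count_filter_of_pos
      (p := fun z : ℂ => z.im = 0 ∧ z.re ∈ I) ⟨Complex.ofReal_im x, by simpa using h2⟩]
    rfl

end Matrix

section Limit

variable {n : ℕ → ℕ} {B : ∀ k, Matrix (Fin (n k)) (Fin (n k)) ℤ} {μ : Measure ℂ}
  [IsProbabilityMeasure μ] {C : ℝ}

/-- Weak convergence of the spectral measures of uniformly bounded integer matrices implies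
convergence at every atom. -/
theorem tendsto_intSpectralMeasure_real_singleton (hn : ∀ k, 0 < n k)
    (hC : ∀ k, ∀ z ∈ (B k).charpoly.aroots ℂ, ‖z‖ ≤ C)
    (hlim : ∀ f : ℂ →ᵇ ℝ, Tendsto (fun k => ∫ z, f z ∂(intSpectralMeasure (B k))) atTop
      (𝓝 (∫ z, f z ∂μ))) (x : ℂ) :
    Tendsto (fun k => (intSpectralMeasure (B k)).real {x}) atTop (𝓝 (μ.real {x})) := by
  have hprob := fun k => isProbabilityMeasure_intSpectralMeasure (B k) (hn k)
  rw [Metric.tendsto_nhds]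
  intro ε hε
  obtain ⟨δ, hδ, hball⟩ := Polynomial.exists_card_filter_ball_le x (half_pos hε) C
  -- Weak convergence bounds the mass of the open ball from below, and at most `ε / 2` of it can lie
  -- off the centre.
  have hlt : μ.real {x} - ε / 2 < μ.real (Metric.ball x δ) := by
    have : μ.real {x} ≤ μ.real (Metric.ball x δ) :=
      measureReal_mono (Set.singleton_subset_iff.mpr (Metric.mem_ball_self hδ))
    linarith
  filter_upwards [eventually_measureReal_lt_of_isClosed hlim (isClosed_singleton (x := x))
    (show μ.real {x} < μ.real {x} + ε by linarith),
    eventually_lt_measureReal_of_isOpen hlim Metric.isOpen_ball hlt] with k h1 h2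
  have h3 := hball _ (B k).charpoly_monic (hC k)
  have hmeas : MeasurableSet {z : ℂ | dist z x < δ ∧ z ≠ x} :=
    Metric.isOpen_ball.measurableSet.inter (measurableSet_singleton x).compl
  have h4 : (intSpectralMeasure (B k)).real {z : ℂ | dist z x < δ ∧ z ≠ x} ≤ ε / 2 := by
    rw [intSpectralMeasure_real _ hmeas]
    apply div_le_of_le_mul₀ (Nat.cast_nonneg _) (by positivity)
    convert h3 using 3
  have h5 : (intSpectralMeasure (B k)).real (Metric.ball x δ)
      ≤ (intSpectralMeasure (B k)).real {x}
        + (intSpectralMeasure (B k)).real {z : ℂ | dist z x < δ ∧ z ≠ x} := by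
    refine (measureReal_mono ?_).trans (measureReal_union_le _ _)
    intro z hz
    by_cases hzx : z = x
    · exact Or.inl hzx
    · exact Or.inr ⟨hz, hzx⟩
  rw [Real.dist_eq, abs_lt]
  constructor <;> linarith

/-- Nonreal eigenvalues close to the line are few by the logarithmic bound; those farther away lie
in a closed set that is null for the limit. -/
theorem tendsto_intSpectralMeasure_real_im_ne_zero (hn : ∀ k, 0 < n k)
    (hB : ∀ k, IsStarNormal ((B k).map (Int.cast : ℤ → ℂ)))
    (hC : ∀ k, ∀ z ∈ (B k).charpoly.aroots ℂ, ‖z‖ ≤ C)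
    (hlim : ∀ f : ℂ →ᵇ ℝ, Tendsto (fun k => ∫ z, f z ∂(intSpectralMeasure (B k))) atTop
      (𝓝 (∫ z, f z ∂μ))) (hμ : ∀ᵐ z ∂μ, z.im = 0) :
    Tendsto (fun k => (intSpectralMeasure (B k)).real {z | z.im ≠ 0}) atTop (𝓝 0) := by
  have hprob := fun k => isProbabilityMeasure_intSpectralMeasure (B k) (hn k)
  rw [Metric.tendsto_nhds]
  intro ε hε
  obtain ⟨δ, hδ, hδ1, hlog⟩ :=
    Polynomial.exists_pos_log_inv_gt (Real.log (2 * max C 1) / (ε / 2))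
  have hL0 : 0 ≤ Real.log (2 * max C 1) :=
    Real.log_nonneg (by linarith [le_max_right C 1])
  have hL : 0 < Real.log δ⁻¹ := lt_of_le_of_lt (by positivity) hlog
  have hclosed : IsClosed {z : ℂ | δ ≤ 2 * |z.im|} :=
    isClosed_le continuous_const (by fun_prop)
  have hzero : μ.real {z : ℂ | δ ≤ 2 * |z.im|} = 0 := by
    rw [measureReal_def, measure_mono_null (t := {z : ℂ | ¬ z.im = 0}) _ hμ, ENNReal.toReal_zero]
    intro z hz h0
    have hz' : δ ≤ 2 * |z.im| := hz
    rw [h0, abs_zero, mul_zero] at hz'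
    linarith
  filter_upwards [eventually_measureReal_lt_of_isClosed hlim hclosed
    (show μ.real {z : ℂ | δ ≤ 2 * |z.im|} < ε / 2 by rw [hzero]; positivity)] with k h1
  have h2 := Matrix.card_filter_im_lt_mul_log_le (hB k) (le_max_right C 1)
    (fun z hz => (hC k z hz).trans (le_max_left C 1)) hδ
  have hmeas : MeasurableSet {z : ℂ | z.im ≠ 0 ∧ 2 * |z.im| < δ} :=
    (Complex.measurable_im (measurableSet_singleton 0)).compl.inter
      (measurableSet_lt (f := fun z : ℂ => 2 * |z.im|) (by fun_prop) measurable_const)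
  have hcard : (0 : ℝ) < ((B k).charpoly.aroots ℂ).card := by
    rw [card_aroots_charpoly]; exact_mod_cast hn k
  have h3 : (intSpectralMeasure (B k)).real {z : ℂ | z.im ≠ 0 ∧ 2 * |z.im| < δ} < ε / 2 := by
    rw [intSpectralMeasure_real _ hmeas]
    rw [div_lt_iff₀ (by positivity)] at hlog
    rw [div_lt_iff₀ hcard]
    have h4 : (((B k).charpoly.aroots ℂ).card : ℝ) * Real.log (2 * max C 1)
        < ((B k).charpoly.aroots ℂ).card * (Real.log δ⁻¹ * (ε / 2)) :=
      mul_lt_mul_of_pos_left hlog hcard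
    refine lt_of_mul_lt_mul_right (a := Real.log δ⁻¹) ?_ hL.le
    refine lt_of_le_of_lt ?_ (h4.trans_eq (by ring))
    convert h2 using 3
  have h5 : (intSpectralMeasure (B k)).real {z : ℂ | z.im ≠ 0}
      ≤ (intSpectralMeasure (B k)).real {z : ℂ | z.im ≠ 0 ∧ 2 * |z.im| < δ}
        + (intSpectralMeasure (B k)).real {z : ℂ | δ ≤ 2 * |z.im|} := by
    refine (measureReal_mono ?_).trans (measureReal_union_le _ _)
    intro z hz
    rcases lt_or_ge (2 * |z.im|) δ with h | h
    · exact Or.inl ⟨hz, h⟩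
    · exact Or.inr h
  rw [Real.dist_eq, sub_zero, abs_of_nonneg measureReal_nonneg]
  linarith

/-- An open and a closed half-plane bound the mass from the two sides. On the closed side the
discrepancy is the atom at `t`, whose mass converges; on the open side it is the vanishing nonreal
mass. -/
theorem tendsto_intSpectralMeasure_real_Iio (hn : ∀ k, 0 < n k)
    (hB : ∀ k, IsStarNormal ((B k).map (Int.cast : ℤ → ℂ)))
    (hC : ∀ k, ∀ z ∈ (B k).charpoly.aroots ℂ, ‖z‖ ≤ C)
    (hlim : ∀ f : ℂ →ᵇ ℝ, Tendsto (fun k => ∫ z, f z ∂(intSpectralMeasure (B k))) atTop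
      (𝓝 (∫ z, f z ∂μ))) (hμ : ∀ᵐ z ∂μ, z.im = 0) (t : ℝ) :
    Tendsto (fun k => (intSpectralMeasure (B k)).real {z | z.im = 0 ∧ z.re ∈ Set.Iio t}) atTop
      (𝓝 (μ.real {z | z.re < t})) := by
  have hprob := fun k => isProbabilityMeasure_intSpectralMeasure (B k) (hn k)
  have hsing := tendsto_intSpectralMeasure_real_singleton hn hC hlim (t : ℂ)
  have hnr := tendsto_intSpectralMeasure_real_im_ne_zero hn hB hC hlim hμ
  have hopen : IsOpen {z : ℂ | z.re < t} := isOpen_lt Complex.continuous_re continuous_const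
  have hclosed : IsClosed {z : ℂ | z.re ≤ t} := isClosed_le Complex.continuous_re continuous_const
  have hμle : μ.real {z : ℂ | z.re ≤ t} ≤ μ.real {z : ℂ | z.re < t} + μ.real {(t : ℂ)} := by
    have h0 : μ.real {z : ℂ | ¬ z.im = 0} = 0 := by
      rw [measureReal_def, show μ {z : ℂ | ¬ z.im = 0} = 0 from hμ, ENNReal.toReal_zero]
    have h1 : μ.real {z : ℂ | z.re ≤ t}
        ≤ μ.real (({z : ℂ | z.re < t} ∪ {(t : ℂ)}) ∪ {z : ℂ | ¬ z.im = 0}) := by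
      refine measureReal_mono ?_
      intro z hz
      by_cases him : z.im = 0
      · rcases lt_or_eq_of_le (show z.re ≤ t from hz) with h | h
        · exact Or.inl (Or.inl h)
        · exact Or.inl (Or.inr (Complex.ext h him))
      · exact Or.inr him
    have h2 := measureReal_union_le (μ := μ) ({z : ℂ | z.re < t} ∪ {(t : ℂ)}) {z : ℂ | ¬ z.im = 0}
    have h3 := measureReal_union_le (μ := μ) {z : ℂ | z.re < t} {(t : ℂ)}
    linarith
  rw [Metric.tendsto_nhds]
  intro ε hε
  filter_upwards [eventually_lt_measureReal_of_isOpen hlim hopen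
      (show μ.real {z : ℂ | z.re < t} - ε / 2 < μ.real {z : ℂ | z.re < t} by linarith),
    eventually_measureReal_lt_of_isClosed hlim hclosed
      (show μ.real {z : ℂ | z.re ≤ t} < μ.real {z : ℂ | z.re ≤ t} + ε / 2 by linarith),
    Metric.tendsto_nhds.mp hsing (ε / 2) (by positivity),
    Metric.tendsto_nhds.mp hnr (ε / 2) (by positivity)] with k h1 h2 h3 h4
  have h5 : (intSpectralMeasure (B k)).real {z : ℂ | z.re < t}
      ≤ (intSpectralMeasure (B k)).real {z | z.im = 0 ∧ z.re ∈ Set.Iio t}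
        + (intSpectralMeasure (B k)).real {z : ℂ | z.im ≠ 0} := by
    refine (measureReal_mono ?_).trans (measureReal_union_le _ _)
    intro z hz
    by_cases him : z.im = 0
    · exact Or.inl ⟨him, hz⟩
    · exact Or.inr him
  have h6 : (intSpectralMeasure (B k)).real {z | z.im = 0 ∧ z.re ∈ Set.Iio t}
      + (intSpectralMeasure (B k)).real {(t : ℂ)}
      ≤ (intSpectralMeasure (B k)).real {z : ℂ | z.re ≤ t} := by
    rw [← measureReal_union _ (measurableSet_singleton _)]
    · refine measureReal_mono ?_
      rintro z (hz | hz)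
      · exact (show z.re < t from hz.2).le
      · rw [Set.mem_singleton_iff.mp hz]; exact le_refl t
    · rw [Set.disjoint_singleton_right]
      intro h
      exact lt_irrefl t h.2
  rw [Real.dist_eq, abs_lt] at *
  constructor <;> linarith [h3.1, h3.2, h4.1, h4.2]

/-- Since `max (a - b) 0 = a - min a b`, it suffices to treat the minima. They converge pointwise to
`w` and are dominated by the summable `w`. -/
theorem tendsto_sum_realEigenvalues_sub_min (hn : ∀ k, 0 < n k)
    (hC : ∀ k, ∀ z ∈ (B k).charpoly.aroots ℂ, ‖z‖ ≤ C)
    (hlim : ∀ f : ℂ →ᵇ ℝ, Tendsto (fun k => ∫ z, f z ∂(intSpectralMeasure (B k))) atTop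
      (𝓝 (∫ z, f z ∂μ))) {w : ℝ → ℝ} (hw : ∀ x : ℝ, w x = μ.real {(x : ℂ)}) (hws : Summable w)
    {I : Set ℝ} (hI : MeasurableSet I) {r : ℝ}
    (hr : Tendsto (fun k => (intSpectralMeasure (B k)).real {z | z.im = 0 ∧ z.re ∈ I}) atTop (𝓝 r)) :
    Tendsto (fun k => ∑ x ∈ realEigenvalues (B k),
        I.indicator (fun x => max ((intSpectralMeasure (B k)).real {(x : ℂ)} - w x) 0) x) atTop
      (𝓝 (r - ∑' x, I.indicator w x)) := by
  have hw0 : ∀ x, 0 ≤ w x := fun x => by rw [hw]; exact measureReal_nonneg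
  have hmin : ∀ k, ∑' x, I.indicator (fun x => min ((intSpectralMeasure (B k)).real {(x : ℂ)}) (w x)) x
      = ∑ x ∈ realEigenvalues (B k),
        I.indicator (fun x => min ((intSpectralMeasure (B k)).real {(x : ℂ)}) (w x)) x := by
    intro k
    refine tsum_eq_sum fun x hx => ?_
    have h0 : (intSpectralMeasure (B k)).real {(x : ℂ)} = 0 := by
      by_contra h
      exact hx ((mem_realEigenvalues _).mpr (mem_aroots_of_intSpectralMeasure_real_ne_zero _ h))
    by_cases hxI : x ∈ I
    · rw [Set.indicator_of_mem hxI, h0, min_eq_left (hw0 x)]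
    · rw [Set.indicator_of_notMem hxI]
  have htannery : Tendsto (fun k => ∑' x,
      I.indicator (fun x => min ((intSpectralMeasure (B k)).real {(x : ℂ)}) (w x)) x) atTop
      (𝓝 (∑' x, I.indicator w x)) := by
    refine tendsto_tsum_of_dominated_convergence hws (fun x => ?_)
      (Eventually.of_forall fun k x => ?_)
    · by_cases hxI : x ∈ I
      · simp only [Set.indicator_of_mem hxI]
        have := (tendsto_intSpectralMeasure_real_singleton hn hC hlim (x : ℂ)).min
          (tendsto_const_nhds (x := w x))
        rwa [← hw, min_self] at this
      · simp only [Set.indicator_of_notMem hxI]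
        exact tendsto_const_nhds
    · by_cases hxI : x ∈ I
      · rw [Set.indicator_of_mem hxI, Real.norm_of_nonneg (le_min measureReal_nonneg (hw0 x))]
        exact min_le_right _ _
      · rw [Set.indicator_of_notMem hxI, norm_zero]
        exact hw0 x
  refine (hr.sub htannery).congr fun k => ?_
  rw [hmin, ← sum_realEigenvalues _ (hn k) hI, ← Finset.sum_sub_distrib]
  refine Finset.sum_congr rfl fun x _ => ?_
  by_cases hxI : x ∈ I
  · simp only [Set.indicator_of_mem hxI]
    rw [← max_sub_sub_left, sub_self, max_comm]
  · simp only [Set.indicator_of_notMem hxI, sub_self]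

end Limit

/-- A default value for matrices whose excess mass is zero, where normalization is impossible. -/
theorem exists_isConvexCombination_dirac_zero :
    ∃ ν : Measure ℝ, IsConvexCombination ν ∧
      ∀ I, MeasurableSet I → ν.real I = I.indicator 1 (0 : ℝ) := by
  obtain ⟨ν, hν, h⟩ := exists_isConvexCombination (S := {0}) (v := Set.indicator {0} fun _ => 1)
    (fun x => Set.indicator_nonneg (fun _ _ => zero_le_one) x)
    (fun x hx => Finset.mem_singleton.mpr (Set.mem_of_indicator_ne_zero (s := {0}) hx))
    (by
      intro x hx
      rw [Finset.mem_singleton.mp hx]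
      refine ⟨isIntegral_zero, fun z hz => ?_⟩
      rw [Complex.ofReal_zero] at hz
      rw [hz.eq_zero, Complex.zero_im])
    (by
      intro x y hxy
      by_cases hx : x = 0
      · subst hx; rw [hxy.eq_zero]
      · have hy : y ≠ 0 := hxy.ne_zero hx
        rw [Set.indicator_of_notMem (by simpa using hy), Set.indicator_of_notMem (by simpa using hx)])
    (by simp)
  refine ⟨ν, hν, fun I hI => ?_⟩
  rw [h I hI, Finset.sum_singleton]
  by_cases h0 : (0 : ℝ) ∈ I <;> simp [h0]

/-- A conjugation invariant finite measure on totally real algebraic integers is, after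
normalization, a convex combination of the measures `μ_α`. -/
theorem exists_isConvexCombination_normalized {S : Finset ℝ} {v : ℝ → ℝ} (hv : ∀ x, 0 ≤ v x)
    (hS : ∀ x, v x ≠ 0 → x ∈ S) (htr : ∀ x ∈ S, IsTotallyRealInteger x)
    (hconj : ∀ x y, IsConjRoot ℚ x y → v y = v x) :
    ∃ ν : Measure ℝ, IsConvexCombination ν ∧ IsProbabilityMeasure ν ∧
      (0 < ∑ x ∈ S, v x → ∀ I, MeasurableSet I →
        ν.real I = (∑ x ∈ S, I.indicator v x) / ∑ x ∈ S, v x) := by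
  rcases (Finset.sum_nonneg fun x (_ : x ∈ S) => hv x).eq_or_lt with h0 | hpos
  · obtain ⟨ν, hν, h⟩ := exists_isConvexCombination_dirac_zero
    refine ⟨ν, hν, ⟨?_⟩, fun hpos => absurd h0 hpos.ne⟩
    rw [← ENNReal.toReal_eq_one_iff]
    simpa [measureReal_def] using h Set.univ .univ
  · obtain ⟨ν, hν, h⟩ := exists_isConvexCombination (S := S) (v := fun x => v x / ∑ x ∈ S, v x)
      (fun x => div_nonneg (hv x) hpos.le)
      (fun x hx => hS x fun h => hx (by simp [h])) htr
      (fun x y hxy => by rw [hconj x y hxy])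
      (by rw [← Finset.sum_div, div_self hpos.ne'])
    refine ⟨ν, hν, ⟨?_⟩, fun _ I hI => ?_⟩
    · rw [← ENNReal.toReal_eq_one_iff]
      have := h Set.univ .univ
      simp only [Set.indicator_univ] at this
      rw [← Finset.sum_div, div_self hpos.ne'] at this
      exact this
    · rw [h I hI, Finset.sum_div]
      refine Finset.sum_congr rfl fun x _ => ?_
      by_cases hx : x ∈ I <;> simp [hx]

end FiniteVN

end

/-! ### The decomposition -/

theorem theorem5p4 {H : Type*} [NormedAddCommGroup H] [InnerProductSpace ℂ H] [CompleteSpace H]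
    (M : VonNeumannAlgebra H) (τ : FiniteVN.Trace M) (A : M.toStarSubalgebra)
    (hA : IsSelfAdjoint A) (hint : τ.IsInteger A) :
    ∃ Ra Rc : ℝ → ℝ,
      (∀ t, τ.distributionFunction A t = Ra t + Rc t) ∧
      ∃ w : ℝ → ℝ,
        -- `Ra` is a step function with summable jumps `w x > 0` at the points of `{x | w x ≠ 0}`
        (∀ x, 0 ≤ w x) ∧ Summable w ∧ Ra = FiniteVN.stepFunction w ∧
        -- the jumps lie at full sets of conjugates, of equal size at conjugate points
        (∀ x, w x ≠ 0 → FiniteVN.IsTotallyRealInteger x) ∧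
        (∀ x y, w x ≠ 0 → IsConjRoot ℚ x y → w y = w x) ∧
        -- `Rc` is continuous and, normalized by its total mass, a uniform limit
        Continuous Rc ∧
        ∃ ν : ℕ → MeasureTheory.Measure ℝ,
          (∀ k, FiniteVN.IsConvexCombination (ν k)) ∧
          TendstoUniformly (fun k t => (1 - ∑' x, w x) * (ν k).real (Set.Iio t)) Rc
            Filter.atTop := by
  obtain ⟨ha, n, B, hn, hB, ⟨C, hBC⟩, hlim⟩ := hint
  have hA' : IsSelfAdjoint (A : H →L[ℂ] H) := congrArg Subtype.val hA
  set μ := τ.spectralMeasure A ha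
  have hC : ∀ k, ∀ z ∈ (B k).charpoly.aroots ℂ, ‖z‖ ≤ C := by
    intro k z hz
    rw [← Matrix.charpoly_map_intCast_roots] at hz
    exact (Matrix.norm_le_of_mem_charpoly_roots hz).trans (hBC k)
  change ∀ f : ℂ →ᵇ ℝ, Tendsto (fun k => ∫ z, f z ∂(FiniteVN.intSpectralMeasure (B k))) atTop
    (𝓝 (∫ z, f z ∂μ)) at hlim
  have hprob := fun k => FiniteVN.isProbabilityMeasure_intSpectralMeasure (B k) (hn k)
  have him : ∀ᵐ z ∂μ, z.im = 0 := by
    filter_upwards [τ.ae_mem_spectrum A ha] with z hz using hA'.im_eq_zero_of_mem_spectrum hz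
  obtain ⟨K, hK⟩ : ∃ K : ℝ, ∀ᵐ z ∂μ, |z.re| ≤ K := by
    refine ⟨‖(A : H →L[ℂ] H)‖ * ‖(1 : H →L[ℂ] H)‖, ?_⟩
    filter_upwards [τ.ae_mem_spectrum A ha] with z hz
    exact (Complex.abs_re_le_norm z).trans (spectrum.norm_le_norm_mul_of_mem hz)
  have hre : Measurable Complex.re := Complex.measurable_re
  set ρ := μ.map Complex.re
  have : IsProbabilityMeasure ρ := Measure.isProbabilityMeasure_map hre.aemeasurable
  have hρ : ∀ t, ρ.real (Set.Iio t) = μ.real {z | z.re < t} := fun t =>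
    map_measureReal_apply hre measurableSet_Iio
  have hρs : ∀ x : ℝ, ρ.real {x} = μ.real {(x : ℂ)} := by
    intro x
    rw [map_measureReal_apply hre (measurableSet_singleton x)]
    apply measureReal_congr
    filter_upwards [him] with z hz
    exact propext ⟨fun h => Complex.ext h hz, fun h => by rw [h]; rfl⟩
  set w : ℝ → ℝ := fun x => ρ.real {x}
  have hw0 : ∀ x, 0 ≤ w x := fun x => measureReal_nonneg
  have hsum : ∀ I, MeasurableSet I → HasSum (I.indicator w) (ρ.real I - ρ.diffusePart.real I) :=
    fun I hI => ρ.hasSum_indicator_singleton hI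
  have huniv := hsum Set.univ .univ
  rw [Set.indicator_univ, probReal_univ] at huniv
  set Rc : ℝ → ℝ := fun t => ρ.diffusePart.real (Set.Iio t)
  have hc : 1 - ∑' x, w x = ρ.diffusePart.real Set.univ := by rw [huniv.tsum_eq]; ring
  have hRcont : Continuous Rc := continuous_measureReal_Iio ρ.diffusePart
  have hatom := FiniteVN.tendsto_intSpectralMeasure_real_singleton hn hC hlim
  have hwconj : ∀ x y : ℝ, IsConjRoot ℚ x y → w y = w x := by
    intro x y hxy
    simp only [w, hρs]
    refine tendsto_nhds_unique (hatom y) ((hatom x).congr fun k => ?_)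
    exact (FiniteVN.intSpectralMeasure_real_singleton_of_isConjRoot _
      (FiniteVN.isConjRoot_ofReal_iff.mpr hxy)).symm
  refine ⟨FiniteVN.stepFunction w, Rc, fun t => ?_, w, hw0, huniv.summable, rfl, fun x hx => ?_,
    fun x y _ hxy => hwconj x y hxy, hRcont, ?_⟩
  · rw [τ.distributionFunction_eq A hA' ha, ← hρ, FiniteVN.stepFunction,
      (hsum (Set.Iio t) measurableSet_Iio).tsum_eq]
    simp only [Rc]
    ring
  -- A nonzero limit cannot come from multiplicities that all vanish, so `x` is an eigenvalue of
  -- some `B k`.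
  · obtain ⟨k, hk⟩ : ∃ k, (FiniteVN.intSpectralMeasure (B k)).real {(x : ℂ)} ≠ 0 := by
      by_contra! h
      apply hx
      simp only [w, hρs]
      exact tendsto_nhds_unique (hatom x) (tendsto_const_nhds.congr fun k => (h k).symm)
    exact FiniteVN.isTotallyRealInteger_of_mem_aroots (hB k)
      (FiniteVN.mem_aroots_of_intSpectralMeasure_real_ne_zero _ hk)
  -- The excess over the limiting atoms; it is conjugation invariant because both terms are.
  · set v : ℕ → ℝ → ℝ := fun k x => max ((FiniteVN.intSpectralMeasure (B k)).real {(x : ℂ)} - w x) 0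
    have hlimv := fun (I : Set ℝ) (hI : MeasurableSet I) (r : ℝ) =>
      FiniteVN.tendsto_sum_realEigenvalues_sub_min hn hC hlim hρs huniv.summable hI (r := r)
    have hlimIio : ∀ t, Tendsto (fun k => ∑ x ∈ FiniteVN.realEigenvalues (B k),
        (Set.Iio t).indicator (v k) x) atTop (𝓝 (Rc t)) := by
      intro t
      have := hlimv (Set.Iio t) measurableSet_Iio _
        (FiniteVN.tendsto_intSpectralMeasure_real_Iio hn hB hC hlim him t)
      rwa [(hsum (Set.Iio t) measurableSet_Iio).tsum_eq, ← hρ, sub_sub_cancel] at this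
    have hlimuniv : Tendsto (fun k => ∑ x ∈ FiniteVN.realEigenvalues (B k), v k x) atTop
        (𝓝 (ρ.diffusePart.real Set.univ)) := by
      have hreal : Tendsto (fun k => (FiniteVN.intSpectralMeasure (B k)).real
          {z | z.im = 0 ∧ z.re ∈ Set.univ}) atTop (𝓝 1) := by
        have h1 := (FiniteVN.tendsto_intSpectralMeasure_real_im_ne_zero hn hB hC hlim him).const_sub 1
        rw [sub_zero] at h1
        refine h1.congr fun k => ?_
        refine (probReal_compl_eq_one_sub (s := {z : ℂ | z.im ≠ 0})
          (Complex.measurable_im (measurableSet_singleton 0)).compl).symm.trans ?_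
        congr 1
        ext z
        simp
      have := hlimv Set.univ .univ _ hreal
      simp only [Set.indicator_univ] at this
      rwa [hc] at this
    have hex := fun k => FiniteVN.exists_isConvexCombination_normalized
      (S := FiniteVN.realEigenvalues (B k)) (v := v k) (fun x => le_max_right _ _)
      (by
        intro x hx
        rw [FiniteVN.mem_realEigenvalues]
        apply FiniteVN.mem_aroots_of_intSpectralMeasure_real_ne_zero
        intro h0
        apply hx
        simp only [v, h0, zero_sub]
        exact max_eq_right (neg_nonpos.mpr (hw0 x)))
      (fun x hx => FiniteVN.isTotallyRealInteger_of_mem_aroots (hB k)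
        ((FiniteVN.mem_realEigenvalues _).mp hx))
      (fun x y hxy => by
        simp only [v]
        rw [hwconj x y hxy, FiniteVN.intSpectralMeasure_real_singleton_of_isConjRoot _
          (FiniteVN.isConjRoot_ofReal_iff.mpr hxy)])
    choose ν hν hνprob hνv using hex
    refine ⟨ν, hν, ?_⟩
    rw [hc]
    set c := ρ.diffusePart.real Set.univ
    have hc0 : 0 ≤ c := measureReal_nonneg
    have hρK : ∀ᵐ x ∂ρ, |x| ≤ K := by
      rw [ae_map_iff hre.aemeasurable (measurableSet_le (by fun_prop) measurable_const)]
      exact hK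
    have hdK : ∀ᵐ x ∂ρ.diffusePart, |x| ≤ K := ae_restrict_of_ae hρK
    -- The measure lives on `[-K, K]`; the endpoint `K + 1` makes the strict inequality hold at
    -- every point of it.
    refine tendstoUniformly_of_monotone_of_continuous (a := -K) (b := K + 1) (c := c) ?_ ?_ ?_
      hRcont ?_ ?_ ?_
    · intro k s t hst
      exact mul_le_mul_of_nonneg_left (measureReal_mono (Set.Iio_subset_Iio hst)) hc0
    · exact fun k t => mul_nonneg hc0 measureReal_nonneg
    · exact fun k t => mul_le_of_le_one_right hc0 measureReal_le_one
    · change (ρ.diffusePart (Set.Iio (-K))).toReal = 0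
      rw [measure_mono_null (t := {x | ¬ |x| ≤ K}) _ hdK, ENNReal.toReal_zero]
      intro x hx
      have hx' : x < -K := hx
      exact fun h => absurd (abs_le.mp h).1 (not_le.mpr hx')
    · apply measureReal_congr
      filter_upwards [hdK] with x hx
      exact propext ⟨fun _ => trivial, fun _ => show x < K + 1 by linarith [(abs_le.mp hx).2]⟩
    · intro t
      -- If `c = 0`, both sides vanish whatever `ν k` is; otherwise the excess mass is eventually
      -- positive and the normalization formula applies.
      rcases hc0.eq_or_lt with h0 | hpos
      · have hR0 : Rc t = 0 :=
          le_antisymm ((measureReal_mono (Set.subset_univ _)).trans h0.ge) measureReal_nonneg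
        simp only [← h0, zero_mul, hR0]
        exact tendsto_const_nhds
      · have h1 := ((hlimIio t).div hlimuniv hpos.ne').const_mul c
        rw [mul_div_cancel₀ _ hpos.ne'] at h1
        refine h1.congr' ?_
        filter_upwards [hlimuniv.eventually_const_lt hpos] with k hk
        rw [hνv k hk _ measurableSet_Iio]
        rfl
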